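/- **Conventions.** For a partition $\lambda$ let $|\lambda|$ be its size, $\ell(\lambda)$ its number of positive parts, $\lambda_1$ its largest part ($\lambda_1=0$ if $\lambda$ is the zero partition), and $\lambda_i=0$ for $i>\ell(\lambda)$. Let $p(k)$ be the number of partitions of size $k$. For $0<i\le j$ let $q_i(j)$ be the number of partitions $\lambda$ of size $j$ whose longest hook-length $\lambda_1+\ell(\lambda)-1$ equals $i$, and let $q_i(j)=0$ for all other integers $i$ (with $j\geq 1$). A *quasi-Dyck vector* is an integer sequence $v_1\cdots v_n$ with $n\ge1$, $v_1=0$ and $v_{i+1}\le v_i+1$. A partition $\lambda$ is identified with its *Dyck class*, the set of all vectors $(0-\lambda_n,\,1-\lambda_{n-1},\dots,\,n-1-\lambda_1)$ with $n>\ell(\lambda)$; every quasi-Dyck vector $v$ lies in exactly one such class $[v]$. Words are written by juxtaposition and $x^c$ means $c$ copies of the symbol $x$. For a partition $\gamma$ with $\gamma_1\le \ell(\gamma)+2$ let $\mathrm{NU}_1(\gamma)$ be the partition with parts $\ell(\gamma)+1,\gamma_1-1,\dots,\gamma_{\ell(\gamma)}-1$ (zeros dropped). The map $\mathrm{NU}_2$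 is given by two rules: (i) $\mathrm{NU}_2([0\,1\,2^hA(-1)^{h-1}])=[0\,0^{h-1}\,1A1^h]$ for $h\ge2$ and $A=A_1\cdots A_s$ an integer list that is empty, or has all $A_i\le2$, $A_s\ge0$ and $A_{i+1}\le A_i+1$ for $i<s$; (ii) $\mathrm{NU}_2([0\,1\,2^mB(-1)^m])=[0\,0^mB\,0\,1^m]$ for $m\ge1$ and $B=B_1\cdots B_s$ an integer list that is empty, or has all $B_i\le2$, $B_1\le1$, $B_s\ge-1$ and $B_{i+1}\le B_i+1$ for $i<s$. Together $\mathrm{NU}_1$ and $\mathrm{NU}_2$ form an injective partial map $\mathrm{NU}$ on partitions; let $\mathrm{ND}$ be its inverse. If $\lambda$ has $n_i$ parts equal to $i$ and $r=\lambda_1$, let $B_\lambda=0\,1^{n_1}0\,1^{n_2}\cdots0\,1^{n_r}$ (the empty word if $\lambda$ is the zero partition), and let $B_\lambda^+$ be $B_\lambda$ with all entries increased by $1$. Let $\mathrm{TI}(\mu)=[0B_\mu]$, and let $\mathrm{TI}_2(\mu)$ be the partition obtained from $\mathrm{TI}(\mu)$ by applying $\mathrm{ND}$ as many times as possible. For $a\ge2$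 let $v(\lambda,a,0)=0\,0\,1\,2^aB_\lambda^+$ and $v(\lambda,a,1)=0\,0\,1\,2^{a-1}B_\lambda^+1$. Let $\lambda\mapsto\lambda^*$ be an involution on the set of all integer partitions. A partition $\mu$ is a *generalized flagpole partition* (relative to this involution) if $\mathrm{TI}_2(\mu)=[V]$ for some $V=v(\lambda,a,\epsilon)$ with $\lambda$ a partition, $a\ge2$ an integer and $\epsilon\in\{0,1\}$, such that the length $L$ of $V$ satisfies $L\ge 5+\lambda_1+\ell(\lambda)$ and $L\ge 5+\lambda_1^*+\ell(\lambda^*)$. **Theorem.** Let $\lambda\mapsto\lambda^*$ be any size-preserving involution on the set of all integer partitions, and let $g(k)$ be the number of generalized flagpole partitions of size $k$ relative to it. (a) For all $k$, $$g(k)\ \ge\ \sum_{j=1}^{k-1}2\max\Big\{0,\ p(j)-2\sum_{i=k-3-j}^{j}q_i(j)\Big\}.$$ (b) For every real $c<1$ and all sufficiently large $k$, $g(k)>p(k)^c$. -/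

import Mathlib

namespace Flagpole

/-- The type of all integer partitions, of all sizes. -/
abbrev Ptn : Type := Σ n : ℕ, n.Partition

/-- The size of a partition. -/
def Ptn.size (la : Ptn) : ℕ := la.1

/-- The multiset of positive parts of a partition. -/
def Ptn.parts (la : Ptn) : Multiset ℕ := la.2.parts

/-- The number of positive parts of a partition. -/
def Ptn.len (la : Ptn) : ℕ := la.parts.card

/-- The largest part `λ₁` of a partition (`0` for the zero partition). -/
def Ptn.largest (la : Ptn) : ℕ := la.parts.sup

/-- The partition whose positive parts are the nonzero members of `s`. -/
def Ptn.ofMultiset (s : Multiset ℕ) : Ptn := ⟨s.sum, Nat.Partition.ofSums s.sum s rfl⟩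

/-- The vector `(0 - λₙ, 1 - λₙ₋₁, …, n - 1 - λ₁)` attached to a partition, where `λᵢ = 0` for
`i` larger than the number of parts. For `n` larger than the number of parts it is a quasi-Dyck
vector. The Dyck class attached to `λ` consists of all these vectors, `n > ℓ(λ)`. -/
def qdv (n : ℕ) (la : Ptn) : List ℤ :=
  (List.range n).map fun i : ℕ => (i : ℤ) - ((la.parts.sort (· ≥ ·)).getD (n - 1 - i) 0 : ℕ)

/-- The Dyck class `[v]` of a quasi-Dyck vector `v = v₁ ⋯ vₙ`, given as the partition which it is
identified with: `λ₁ = n - 1 - vₙ`, `λ₂ = n - 2 - vₙ₋₁`, …, `λₙ = 0 - v₁`, zeros being dropped.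
(For a quasi-Dyck vector all these numbers are nonnegative.) -/
def dyckClass (v : List ℤ) : Ptn :=
  Ptn.ofMultiset (v.mapIdx fun i x => ((i : ℤ) - x).toNat : List ℕ)

theorem Ptn.ext_parts {la mu : Ptn} (h : la.parts = mu.parts) : la = mu := by
  obtain ⟨n, s, hs, rfl⟩ := la
  obtain ⟨m, t, ht, rfl⟩ := mu
  obtain rfl : s = t := h
  rfl

/-- Every partition is the Dyck class of each of its vectors. -/
theorem dyckClass_qdv (n : ℕ) (la : Ptn) (hn : la.len < n) : dyckClass (qdv n la) = la := by
  set s : List ℕ := la.parts.sort (· ≥ ·) with hs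
  have hlen : s.length = la.len := by simp [hs, Ptn.len]
  have h1 : ((qdv n la).mapIdx fun i x => ((i : ℤ) - x).toNat) =
      (s ++ List.replicate (n - s.length) 0).reverse := by
    apply List.ext_getElem
    · simp [qdv]; omega
    · intro i h₁ h₂
      have hi : i < n := by simpa [qdv] using h₁
      simp only [qdv, List.getElem_mapIdx, List.getElem_map, List.getElem_range,
        List.getElem_reverse, ← hs]
      have : (s ++ List.replicate (n - s.length) 0).length - 1 - i = n - 1 - i := by
        simp; omega
      simp only [this, List.getElem_append, List.getD_eq_getElem?_getD]
      split_ifs with hc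
      · simp [hc]
      · simp [not_lt.mp hc]
  apply Ptn.ext_parts
  rw [dyckClass, h1]
  have h2 : (s : Multiset ℕ) = la.parts := by simp [hs]
  have h3 : ∀ x ∈ la.parts, x ≠ 0 := fun x hx => (la.2.parts_pos hx).ne'
  have h4 : (((s ++ List.replicate (n - s.length) 0).reverse : List ℕ) : Multiset ℕ) =
      la.parts + Multiset.replicate (n - s.length) 0 := by
    rw [Multiset.coe_reverse, ← Multiset.coe_add, h2, Multiset.coe_replicate]
  rw [h4]
  simp only [Ptn.parts, Ptn.ofMultiset, Nat.Partition.ofSums] at *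
  rw [Multiset.filter_add, Multiset.filter_eq_self.mpr h3]
  simp [Multiset.filter_eq_nil, Multiset.mem_replicate]

/-- Equivalent vectors `v` and `0 v⁺` have the same Dyck class. -/
theorem dyckClass_shift (v : List ℤ) : dyckClass (0 :: v.map (fun x => x + 1)) = dyckClass v := by
  apply Ptn.ext_parts
  have h : (v.map (fun x => x + 1)).mapIdx (fun i x => ((i : ℤ) + 1 - x).toNat) =
      v.mapIdx fun i x => ((i : ℤ) - x).toNat := by
    apply List.ext_getElem <;> simp
  simp [dyckClass, Ptn.parts, Ptn.ofMultiset, Nat.Partition.ofSums, List.mapIdx_cons, h]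

/-- The word `B_λ = 0 1^{n₁} 0 1^{n₂} ⋯ 0 1^{n_r}`, where `r = λ₁` and `nᵢ` is the number of parts
of `λ` that are equal to `i`; it is empty for the zero partition. -/
def bWord (la : Ptn) : List ℤ :=
  (List.range la.largest).flatMap fun i => 0 :: List.replicate (la.parts.count (i + 1)) 1

/-- The tail-initiator `TI(μ) = [0 B_μ]`. -/
def TI (mu : Ptn) : Ptn := dyckClass (0 :: bWord mu)

/-- `NU1 γ δ` means that `γ₁ ≤ ℓ(γ) + 2`, so that `NU₁(γ)` is defined, and that
`δ = NU₁(γ) = ⟨ℓ + 1, γ₁ - 1, …, γ_ℓ - 1⟩` where `ℓ = ℓ(γ)`. -/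
def NU1 (ga de : Ptn) : Prop :=
  ga.largest ≤ ga.len + 2 ∧
    de = Ptn.ofMultiset ((ga.len + 1) ::ₘ ga.parts.map (fun x => x - 1))

/-- `NU2 γ δ` means that `NU₂(γ)` is defined and equal to `δ`. The two rules are
`NU₂([0 1 2^h A (-1)^(h-1)]) = [0 0^(h-1) 1 A 1^h]` and
`NU₂([0 1 2^k B (-1)^k]) = [0 0^k B 0 1^k]`, where `A` and `B` may be empty. -/
inductive NU2 : Ptn → Ptn → Prop
  | ruleA (h : ℕ) (A : List ℤ) (hh : 2 ≤ h) (hle : ∀ x ∈ A, x ≤ 2)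
      (hlast : ∀ x ∈ A.getLast?, 0 ≤ x) (hstep : A.IsChain (fun x y => y ≤ x + 1)) :
      NU2 (dyckClass ([0, 1] ++ List.replicate h 2 ++ A ++ List.replicate (h - 1) (-1)))
        (dyckClass ([0] ++ List.replicate (h - 1) 0 ++ [1] ++ A ++ List.replicate h 1))
  | ruleB (k : ℕ) (B : List ℤ) (hk : 1 ≤ k) (hle : ∀ x ∈ B, x ≤ 2)
      (hhead : ∀ x ∈ B.head?, x ≤ 1) (hlast : ∀ x ∈ B.getLast?, -1 ≤ x)
      (hstep : B.IsChain (fun x y => y ≤ x + 1)) :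
      NU2 (dyckClass ([0, 1] ++ List.replicate k 2 ++ B ++ List.replicate k (-1)))
        (dyckClass ([0] ++ List.replicate k 0 ++ B ++ [0] ++ List.replicate k 1))

/-- The graph of the extended next-up map `NU`. -/
def NU (ga de : Ptn) : Prop := NU1 ga de ∨ NU2 ga de

/-- The graph of the extended next-down map `ND`, the inverse of the bijection `NU`. -/
def ND (ga de : Ptn) : Prop := NU de ga

/-- `IsTI2 μ τ` means that `τ` is the second-order tail initiator `TI₂(μ)`: it is reached from
`TI(μ)` by iterating `ND` until `ND` is not defined any more. -/
def IsTI2 (mu ta : Ptn) : Prop :=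
  Relation.ReflTransGen ND (TI mu) ta ∧ ∀ de, ¬ ND ta de

/-- The vectors `v(λ, a, 0) = 0 0 1 2^a B_λ⁺` and `v(λ, a, 1) = 0 0 1 2^(a-1) B_λ⁺ 1`, where `B⁺` is
`B` with all entries increased by one. They are used for `a ≥ 2` only. -/
def flagVec (la : Ptn) (a : ℕ) (ep : Fin 2) : List ℤ :=
  [0, 0, 1] ++ List.replicate (a - ep.val) 2 ++ (bWord la).map (fun x => x + 1) ++
    List.replicate ep.val 1

/-- Generalized flagpole partitions relative to an involution `λ ↦ λ*` that is defined on all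
partitions. -/
def IsGenFlagpole (star : Ptn → Ptn) (mu : Ptn) : Prop :=
  ∃ (la : Ptn) (a : ℕ) (ep : Fin 2), 2 ≤ a ∧ IsTI2 mu (dyckClass (flagVec la a ep)) ∧
    5 + la.largest + la.len ≤ (flagVec la a ep).length ∧
    5 + (star la).largest + (star la).len ≤ (flagVec la a ep).length

/-- The number `g(k)` of generalized flagpole partitions of size `k`. -/
noncomputable def g (star : Ptn → Ptn) (k : ℕ) : ℕ :=
  {mu : Ptn | mu.size = k ∧ IsGenFlagpole star mu}.ncard

/-- The number `p(k)` of partitions of size `k`. -/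
def p (k : ℕ) : ℕ := Fintype.card (Nat.Partition k)

/-- The longest hook-length `h(λ) = λ₁ + ℓ(λ) - 1` of a nonzero partition. -/
def longestHook (la : Ptn) : ℤ := (la.largest : ℤ) + la.len - 1

/-- The number `q_i(j)` of partitions of size `j` whose longest hook-length is `i`. -/
noncomputable def q (i : ℤ) (j : ℕ) : ℕ :=
  {la : Ptn | la.size = j ∧ longestHook la = i}.ncard

end Flagpole

/-! The core is that every flagpole vector V = v(λ, a, ε) with a ≥ 2 represents TI₂(μ) for some μ
with |μ| = |λ| + a + 1 + λ₁ + ℓ(λ). Three facts give this. `NU.injective` makes ND a partial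
function, so TI₂(μ) is unique, and `not_ND_flagVec` shows that ND is undefined at [V]. Iterating NU
from [V] reaches some TI(μ) (`endsInTail`): NU₁ rotates the word until its first 2 follows a single
1, then NU₂ lowers the number of 2s. Finally, a deficit statistic agrees at successive checkpoints
of the iteration and equals |μ| at the end, so |μ| can be read off V.

For (a), fix |μ| = k and |λ| = j. Then a is determined by λ, and V has length k + 2 - j, so the two
length conditions become upper bounds on the longest hooks of λ and λ*. Distinct pairs (λ, ε) give
distinct μ, and a union bound over the two hook conditions gives the sum (`sum_card_le_g`,
`card_short_hooks`).

For (b), the single term j = k - r with r = ⌊k/(M+1)⌋ suffices. Few partitions of j have a hook of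
length about r, so g(k) ≥ p(j) (`eventually_p_le_g`). Comparing p(j) with p(k) uses only p(a+b) ≤
(a+b+1)² p(a) p(b), p(a)² ≤ p(5a) and superpolynomial growth of p, all obtained by explicit
injections and double counting. -/

namespace Flagpole

/-! ### Vectors and partitions -/

/-- Each entry exceeds its predecessor by at most one. -/
abbrev Climb (v : List ℤ) : Prop := v.IsChain (fun x y => y ≤ x + 1)

/-- The numbers `n - x₁, n + 1 - x₂, …` for a list `x₁, x₂, …`. -/
def gaps : ℤ → List ℤ → List ℕ
  | _, [] => []
  | n, x :: l => (n - x).toNat :: gaps (n + 1) l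

theorem mapIdx_eq_gaps (v : List ℤ) (n : ℤ) :
    v.mapIdx (fun i x => ((i : ℤ) + n - x).toNat) = gaps n v := by
  induction v generalizing n with
  | nil => rfl
  | cons x l ih =>
    rw [List.mapIdx_cons, gaps, ← ih]
    congr 1
    · simp
    · congr 1
      funext i y
      push_cast
      congr 1
      ring

theorem gaps_append (n : ℤ) (A B : List ℤ) :
    gaps n (A ++ B) = gaps n A ++ gaps (n + A.length) B := by
  induction A generalizing n with
  | nil => simp [gaps]
  | cons x l ih =>
    simp only [List.cons_append, gaps, ih, List.length_cons, Nat.cast_add, Nat.cast_one]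
    congr 3
    ring

theorem length_gaps (n : ℤ) (A : List ℤ) : (gaps n A).length = A.length := by
  induction A generalizing n with
  | nil => rfl
  | cons x l ih => simp [gaps, ih]

theorem gaps_map_succ (n : ℤ) (A : List ℤ) :
    gaps n (A.map (fun x => x + 1)) = (gaps n A).map (fun x => x - 1) := by
  induction A generalizing n with
  | nil => rfl
  | cons x l ih =>
    simp only [List.map_cons, gaps, ih, List.cons.injEq, and_true]
    omega

theorem Ptn.parts_ofMultiset (s : Multiset ℕ) : (Ptn.ofMultiset s).parts = s.filter (· ≠ 0) := rfl

theorem parts_dyckClass (v : List ℤ) :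
    (dyckClass v).parts = ((gaps 0 v : List ℕ) : Multiset ℕ).filter (· ≠ 0) := by
  rw [dyckClass, Ptn.parts_ofMultiset, ← mapIdx_eq_gaps]
  simp

theorem parts_dyckClass_zero (R : List ℤ) :
    (dyckClass (0 :: R)).parts = ((gaps 1 R : List ℕ) : Multiset ℕ).filter (· ≠ 0) := by
  rw [parts_dyckClass]
  simp [gaps]

theorem gaps_pos {n : ℤ} {R : List ℤ} (hc : Climb R) (hh : ∀ x ∈ R.head?, x ≤ n - 1) :
    ∀ y ∈ gaps n R, y ≠ 0 := by
  induction R generalizing n with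
  | nil => simp [gaps]
  | cons x l ih =>
    rw [Climb, List.isChain_cons] at hc
    have hx : x ≤ n - 1 := hh x (by simp)
    intro y hy
    rw [gaps, List.mem_cons] at hy
    rcases hy with rfl | hy
    · omega
    · refine ih hc.2 (fun z hz => ?_) y hy
      have := hc.1 z hz
      omega

/-- Climbing makes the differences between position and letter weakly increase, so the last one
dominates. The `max 0` absorbs the truncation in `toNat`. -/
theorem gaps_le {n : ℤ} {R : List ℤ} (hc : Climb R) {z : ℤ} (hz : z ∈ R.getLast?) :
    ∀ y ∈ gaps n R, (y : ℤ) ≤ max 0 (n + R.length - 1 - z) := by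
  induction R generalizing n with
  | nil => simp at hz
  | cons x l ih =>
    rcases l with _ | ⟨w, l⟩
    · simp only [List.getLast?_singleton, Option.mem_def, Option.some.injEq] at hz
      subst hz
      simp [gaps, le_total]
    · rw [Climb, List.isChain_cons_cons] at hc
      have hz' : z ∈ (w :: l).getLast? := by simpa using hz
      have h := ih (n := n + 1) hc.2 hz'
      have e : n + 1 + ((w :: l).length : ℤ) - 1 - z = n + ((x :: w :: l).length : ℤ) - 1 - z := by
        push_cast [List.length_cons]; ring
      rw [e] at h
      intro y hy
      rw [gaps, List.mem_cons] at hy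
      rcases hy with rfl | hy
      · refine le_trans ?_ (h (n + 1 - w).toNat (by simp [gaps]))
        have := hc.1
        omega
      · exact h y hy

theorem gaps_sorted {n : ℤ} {R : List ℤ} (hc : Climb R) : (gaps n R).Pairwise (· ≤ ·) := by
  rw [← List.isChain_iff_pairwise]
  induction R generalizing n with
  | nil => simp [gaps]
  | cons x l ih =>
    rw [Climb, List.isChain_cons] at hc
    rw [gaps, List.isChain_cons]
    refine ⟨?_, ih hc.2⟩
    rcases l with _ | ⟨w, l⟩
    · simp [gaps]
    · simp only [gaps, List.head?_cons, Option.mem_def, Option.some.injEq]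
      rintro y rfl
      have := hc.1 w (by simp)
      omega

theorem gaps_injective {n : ℤ} {R S : List ℤ} (hR : ∀ y ∈ gaps n R, y ≠ 0)
    (hS : ∀ y ∈ gaps n S, y ≠ 0) (h : gaps n R = gaps n S) : R = S := by
  induction R generalizing n S with
  | nil =>
    have := congrArg List.length h
    rw [length_gaps, length_gaps] at this
    exact (List.length_eq_zero_iff.mp this.symm).symm
  | cons x l ih =>
    rcases S with _ | ⟨y, m⟩
    · simp [gaps] at h
    · simp only [gaps, List.cons.injEq, List.mem_cons, forall_eq_or_imp] at h hR hS
      have := ih hR.2 hS.2 h.2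
      have : x = y := by omega
      simp_all

theorem parts_dyckClass_reduced {R : List ℤ} (hc : Climb R) (hh : ∀ x ∈ R.head?, x ≤ 0) :
    (dyckClass (0 :: R)).parts = (gaps 1 R : List ℕ) := by
  rw [parts_dyckClass_zero, Multiset.filter_eq_self]
  intro y hy
  exact gaps_pos (n := 1) hc (by simpa using hh) y (by simpa using hy)

/-- Under these hypotheses R lists the parts in increasing order without zeros, so the vector is the
shortest representative of its class and can be recovered from the sorted parts. -/
theorem dyckClass_injective {R S : List ℤ} (hR : Climb R) (hR' : ∀ x ∈ R.head?, x ≤ 0)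
    (hS : Climb S) (hS' : ∀ x ∈ S.head?, x ≤ 0) (h : dyckClass (0 :: R) = dyckClass (0 :: S)) :
    R = S := by
  have h1 := congrArg Ptn.parts h
  rw [parts_dyckClass_reduced hR hR', parts_dyckClass_reduced hS hS', Multiset.coe_eq_coe] at h1
  exact gaps_injective (gaps_pos hR (by simpa using hR')) (gaps_pos hS (by simpa using hS'))
    (h1.eq_of_pairwise' (gaps_sorted hR) (gaps_sorted hS))

/-! ### Injectivity of the next-up map -/

theorem Ptn.le_largest {la : Ptn} {x : ℕ} (hx : x ∈ la.parts) : x ≤ la.largest :=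
  Multiset.le_sup hx

theorem Ptn.parts_pos {la : Ptn} {x : ℕ} (hx : x ∈ la.parts) : 0 < x := la.2.parts_pos hx

theorem NU1.parts {ga de : Ptn} (h : NU1 ga de) :
    de.parts = (ga.len + 1) ::ₘ (ga.parts.map (fun x => x - 1)).filter (· ≠ 0) := by
  rw [h.2, Ptn.parts_ofMultiset, Multiset.filter_cons_of_pos _ (by simp)]

theorem NU1.largest {ga de : Ptn} (h : NU1 ga de) : de.largest = ga.len + 1 := by
  rw [Ptn.largest, h.parts, Multiset.sup_cons]
  apply sup_of_le_left
  rw [Multiset.sup_le]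
  intro b hb
  obtain ⟨x, hx, rfl⟩ := Multiset.mem_map.mp (Multiset.mem_of_mem_filter hb)
  have := Ptn.le_largest hx
  have := h.1
  omega

/-- Together with the reverse strict inequality `NU2.largest_lt`, this keeps the images of the two
maps disjoint. -/
theorem NU1.len_le {ga de : Ptn} (h : NU1 ga de) : de.len ≤ de.largest := by
  rw [h.largest, Ptn.len, h.parts, Multiset.card_cons]
  refine Nat.succ_le_succ ((Multiset.card_le_card (Multiset.filter_le _ _)).trans ?_)
  rw [Multiset.card_map, Ptn.len]

/-- Deleting the first column forgets only the number of parts equal to 1, and the length restores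
it. -/
theorem Ptn.eq_of_filter_map_pred {la mu : Ptn} (hl : la.len = mu.len)
    (e : (la.parts.map (fun x => x - 1)).filter (· ≠ 0) =
      (mu.parts.map (fun x => x - 1)).filter (· ≠ 0)) : la = mu := by
  have key : ∀ la : Ptn, la.parts = ((la.parts.map (fun x => x - 1)).filter (· ≠ 0) +
      Multiset.replicate (la.len - ((la.parts.map (fun x => x - 1)).filter (· ≠ 0)).card) 0).map
        (fun x => x + 1) := by
    intro la
    have h1 := Multiset.filter_add_not (fun x : ℕ => x ≠ 0) (la.parts.map (fun x => x - 1))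
    have h2 : (la.parts.map (fun x => x - 1)).filter (fun x => ¬ x ≠ 0) =
        Multiset.replicate ((la.parts.map (fun x => x - 1)).filter (fun x => ¬ x ≠ 0)).card 0 := by
      rw [Multiset.eq_replicate_card]
      intro b hb
      simpa using (Multiset.mem_filter.mp hb).2
    have h3 := congrArg Multiset.card h1
    rw [Multiset.card_add, Multiset.card_map] at h3
    rw [Ptn.len, ← h3, Nat.add_sub_cancel_left, ← h2, h1, Multiset.map_map]
    symm
    convert Multiset.map_id' la.parts using 1
    refine Multiset.map_congr rfl fun x hx => ?_
    have := Ptn.parts_pos hx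
    simp only [Function.comp_apply]
    omega
  apply Ptn.ext_parts
  rw [key la, key mu, e, hl]

theorem NU1.injective {ga ga' de : Ptn} (h : NU1 ga de) (h' : NU1 ga' de) : ga = ga' := by
  have hl : ga.len = ga'.len := by
    have := h.largest.symm.trans h'.largest
    omega
  have e := h.parts.symm.trans h'.parts
  rw [hl, Multiset.cons_inj_right] at e
  exact Ptn.eq_of_filter_map_pred hl e

theorem climb_replicate (n : ℕ) (a : ℤ) : Climb (List.replicate n a) :=
  List.isChain_replicate_of_rel n (by omega)

/-- Here ℓ is the length of X, and the largest part is at most ℓ - z, read off at the last letter.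
-/
theorem largest_lt_len {X : List ℤ} {z : ℤ} (hX : X ≠ []) (hz : 1 ≤ z) (hc : Climb X)
    (hl : z ∈ X.getLast?) (hh : ∀ x ∈ X.head?, x ≤ 0) :
    (dyckClass (0 :: X)).largest < (dyckClass (0 :: X)).len := by
  have hp := parts_dyckClass_reduced hc hh
  have hlen : (dyckClass (0 :: X)).len = X.length := by
    rw [Ptn.len, hp, Multiset.coe_card, length_gaps]
  have h0 : 0 < X.length := List.length_pos_of_ne_nil hX
  rw [hlen, Ptn.largest]
  refine lt_of_le_of_lt (Multiset.sup_le (a := X.length - 1).mpr fun b hb => ?_) (by omega)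
  rw [hp] at hb
  have := gaps_le (n := 1) hc hl b (by simpa using hb)
  omega

/-- The vector in the image of the first rule for `NU₂`, without its initial zero. -/
def imageA (h : ℕ) (A : List ℤ) : List ℤ :=
  List.replicate (h - 1) 0 ++ 1 :: (A ++ List.replicate h 1)

/-- The vector in the image of the second rule for `NU₂`, without its initial zero. -/
def imageB (k : ℕ) (B : List ℤ) : List ℤ :=
  List.replicate k 0 ++ (B ++ 0 :: List.replicate k 1)

/-- Hypotheses on the middle word in the first rule for `NU₂`. -/
structure MidA (h : ℕ) (A : List ℤ) : Prop where
  hh : 2 ≤ h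
  hle : ∀ x ∈ A, x ≤ 2
  hlast : ∀ x ∈ A.getLast?, 0 ≤ x
  hstep : Climb A

/-- Hypotheses on the middle word in the second rule for `NU₂`. -/
structure MidB (k : ℕ) (B : List ℤ) : Prop where
  hk : 1 ≤ k
  hle : ∀ x ∈ B, x ≤ 2
  hhead : ∀ x ∈ B.head?, x ≤ 1
  hlast : ∀ x ∈ B.getLast?, -1 ≤ x
  hstep : Climb B

theorem NU2_iff {ga de : Ptn} : NU2 ga de ↔
    (∃ h A, MidA h A ∧
      ga = dyckClass (0 :: 1 :: (List.replicate h 2 ++ (A ++ List.replicate (h - 1) (-1)))) ∧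
      de = dyckClass (0 :: imageA h A)) ∨
    (∃ k B, MidB k B ∧
      ga = dyckClass (0 :: 1 :: (List.replicate k 2 ++ (B ++ List.replicate k (-1)))) ∧
      de = dyckClass (0 :: imageB k B)) := by
  constructor
  · rintro (⟨h, A, h1, h2, h3, h4⟩ | ⟨k, B, h1, h2, h3, h4, h5⟩)
    · exact Or.inl ⟨h, A, ⟨h1, h2, h3, h4⟩, by simp, by simp [imageA]⟩
    · exact Or.inr ⟨k, B, ⟨h1, h2, h3, h4, h5⟩, by simp, by simp [imageB]⟩
  · rintro (⟨h, A, ⟨h1, h2, h3, h4⟩, rfl, rfl⟩ | ⟨k, B, ⟨h1, h2, h3, h4, h5⟩, rfl, rfl⟩)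
    · simpa [imageA] using NU2.ruleA h A h1 h2 h3 h4
    · simpa [imageB] using NU2.ruleB k B h1 h2 h3 h4 h5

theorem MidA.climb {h : ℕ} {A : List ℤ} (m : MidA h A) : Climb (imageA h A) := by
  rw [imageA, Climb, List.isChain_append, List.isChain_cons, List.isChain_append]
  refine ⟨climb_replicate _ _, ⟨?_, m.hstep, climb_replicate _ _, ?_⟩, ?_⟩
  · intro y hy
    rw [List.head?_append] at hy
    rcases A with _ | ⟨a, A⟩
    · simp only [List.head?_nil, Option.none_or, List.head?_replicate] at hy
      split_ifs at hy <;> simp_all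
      omega
    · have := m.hle a (by simp)
      simp at hy
      omega
  · intro x hx y hy
    have := m.hlast x hx
    simp only [List.head?_replicate] at hy
    split_ifs at hy <;> simp_all
  · intro x hx y hy
    simp only [List.getLast?_replicate] at hx
    split_ifs at hx <;> simp_all

theorem MidB.climb {k : ℕ} {B : List ℤ} (m : MidB k B) : Climb (imageB k B) := by
  rw [imageB, Climb, List.isChain_append, List.isChain_append, List.isChain_cons]
  refine ⟨climb_replicate _ _, ⟨m.hstep, ⟨?_, climb_replicate _ _⟩, ?_⟩, ?_⟩
  · intro y hy
    simp only [List.head?_replicate] at hy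
    split_ifs at hy <;> simp_all
  · intro x hx y hy
    have := m.hlast x hx
    simp only [List.head?_cons, Option.mem_def, Option.some.injEq] at hy
    omega
  · intro x hx y hy
    simp only [List.getLast?_replicate] at hx
    have hx0 : x = 0 := by split_ifs at hx <;> simp_all
    rw [List.head?_append] at hy
    rcases B with _ | ⟨b, B⟩
    · simp at hy
      simp [hx0, ← hy]
    · have := m.hhead b (by simp)
      simp at hy
      omega

theorem MidA.head {h : ℕ} {A : List ℤ} (m : MidA h A) : ∀ x ∈ (imageA h A).head?, x ≤ 0 := by
  obtain ⟨n, rfl⟩ := Nat.exists_eq_add_of_le m.hh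
  simp [imageA, show 2 + n - 1 = n + 1 by omega, List.replicate_succ]

theorem MidB.head {k : ℕ} {B : List ℤ} (m : MidB k B) : ∀ x ∈ (imageB k B).head?, x ≤ 0 := by
  obtain ⟨n, rfl⟩ := Nat.exists_eq_add_of_le m.hk
  simp [imageB, Nat.add_comm 1 n, List.replicate_succ]

theorem MidA.ending {h : ℕ} {A : List ℤ} (m : MidA h A) :
    ∃ X, imageA h A = X ++ [1, 1] := by
  obtain ⟨n, rfl⟩ := Nat.exists_eq_add_of_le m.hh
  refine ⟨List.replicate (n + 1) 0 ++ 1 :: (A ++ List.replicate n 1), ?_⟩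
  rw [imageA, Nat.add_comm 2 n, List.replicate_add n 2]
  simp [List.replicate_succ]

theorem MidB.ending {k : ℕ} {B : List ℤ} (m : MidB k B) :
    ∃ X y, y ≤ 1 ∧ imageB k B = X ++ [y, 1] := by
  obtain ⟨n, rfl⟩ := Nat.exists_eq_add_of_le m.hk
  rcases n with _ | n
  · exact ⟨0 :: B, 0, by simp, by simp [imageB]⟩
  · refine ⟨List.replicate (n + 2) 0 ++ (B ++ 0 :: List.replicate n 1), 1, le_rfl, ?_⟩
    rw [imageB, show 1 + (n + 1) = n + 2 by ring, List.replicate_add n 2 (1 : ℤ)]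
    simp [List.replicate_succ]

theorem NU2.image {ga de : Ptn} (h : NU2 ga de) :
    ∃ X y, y ≤ 1 ∧ Climb (X ++ [y, 1]) ∧ (∀ x ∈ (X ++ [y, 1]).head?, x ≤ 0) ∧
      de = dyckClass (0 :: (X ++ [y, 1])) := by
  rcases NU2_iff.mp h with ⟨h, A, m, -, rfl⟩ | ⟨k, B, m, -, rfl⟩
  · obtain ⟨X, e⟩ := m.ending
    exact ⟨X, 1, le_rfl, e ▸ m.climb, e ▸ m.head, by rw [e]⟩
  · obtain ⟨X, y, hy, e⟩ := m.ending
    exact ⟨X, y, hy, e ▸ m.climb, e ▸ m.head, by rw [e]⟩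

theorem NU2.largest_lt {ga de : Ptn} (h : NU2 ga de) : de.largest < de.len := by
  obtain ⟨X, y, -, hc, hh, rfl⟩ := h.image
  exact largest_lt_len (z := 1) (by simp) le_rfl hc (by simp) hh

theorem replicate_append_cons_inj {a b c : ℤ} {m n : ℕ} {X Y : List ℤ} (hb : b ≠ a) (hc : c ≠ a)
    (h : List.replicate m a ++ b :: X = List.replicate n a ++ c :: Y) :
    m = n ∧ b = c ∧ X = Y := by
  induction m generalizing n with
  | zero => rcases n with _ | n <;> simp_all [List.replicate_succ]
  | succ m ih =>
    rcases n with _ | n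
    · simp [List.replicate_succ] at h
      exact absurd h.1.symm hc
    · simp only [List.replicate_succ, List.cons_append, List.cons.injEq, true_and] at h
      obtain ⟨h1, h2⟩ := ih h
      exact ⟨by omega, h2⟩

theorem length_le_of_replicate_append {a b : ℤ} {m n : ℕ} {X Y : List ℤ} (hb : b ≠ a)
    (h : List.replicate m a ++ X = List.replicate n a ++ b :: Y) : m ≤ n := by
  induction m generalizing n with
  | zero => omega
  | succ m ih =>
    rcases n with _ | n
    · simp [List.replicate_succ] at h
      exact absurd h.1.symm hb
    · simp only [List.replicate_succ, List.cons_append, List.cons.injEq, true_and] at h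
      have := ih h
      omega

theorem NU2.injective {ga ga' de : Ptn} (h : NU2 ga de) (h' : NU2 ga' de) : ga = ga' := by
  -- An `imageA` word has exactly h - 1 leading zeros and at least h final ones; an `imageB` word
  -- has at least k leading zeros and exactly k final ones. Equality would force h ≤ k ≤ h - 1.
  have mixed : ∀ {h A k B}, MidA h A → MidB k B → imageA h A ≠ imageB k B := by
    intro h A k B m m' e
    have e' := congrArg List.reverse e
    simp only [imageA, imageB, List.reverse_append, List.reverse_cons, List.reverse_replicate,
      List.append_assoc, List.singleton_append] at e e'
    have h1 := length_le_of_replicate_append (by norm_num) e'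
    have h2 := length_le_of_replicate_append (by norm_num) e.symm
    have := m.hh
    omega
  rcases NU2_iff.mp h with ⟨r, A, m, rfl, rfl⟩ | ⟨k, B, m, rfl, rfl⟩ <;>
    rcases NU2_iff.mp h' with ⟨r', A', m', rfl, e⟩ | ⟨k', B', m', rfl, e⟩ <;>
    replace e := dyckClass_injective m.climb m.head m'.climb m'.head e
  -- For the first rule the initial run of zeros determines h; for the second, the final run of ones
  -- determines k, hence the reversal below.
  · obtain ⟨h1, -, h2⟩ := replicate_append_cons_inj one_ne_zero one_ne_zero e
    have := m.hh
    have := m'.hh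
    obtain rfl : r = r' := by omega
    rw [List.append_cancel_right h2]
  · exact (mixed m m' e).elim
  · exact (mixed m' m e.symm).elim
  · have e' := congrArg List.reverse e
    simp only [imageB, List.reverse_append, List.reverse_cons, List.reverse_replicate,
      List.append_assoc, List.singleton_append] at e'
    obtain ⟨rfl, -, h2⟩ := replicate_append_cons_inj zero_ne_one zero_ne_one e'
    rw [List.reverse_injective (List.append_cancel_right h2)]

theorem NU.injective {ga ga' de : Ptn} (h : NU ga de) (h' : NU ga' de) : ga = ga' := by
  rcases h with h | h <;> rcases h' with h' | h'
  · exact h.injective h'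
  · exact absurd h.len_le h'.largest_lt.not_ge
  · exact absurd h'.len_le h.largest_lt.not_ge
  · exact h.injective h'

/-- The ND-iterates of TI(μ) form a single chain, which has at most one terminal element. -/
theorem IsTI2.unique {mu ta ta' : Ptn} (h : IsTI2 mu ta) (h' : IsTI2 mu ta') : ta = ta' := by
  have hu : Relator.RightUnique ND := fun _ _ _ hb hc => NU.injective hb hc
  rcases Relation.ReflTransGen.total_of_right_unique hu h.1 h'.1 with hr | hr
  · rcases Relation.ReflTransGen.cases_head hr with rfl | ⟨c, hc, -⟩
    · rfl
    · exact absurd hc (h.2 c)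
  · rcases Relation.ReflTransGen.cases_head hr with rfl | ⟨c, hc, -⟩
    · rfl
    · exact absurd hc (h'.2 c)

/-! ### Binary words and partitions -/

/-- The letters of `l` are `b` and `b + 1`. -/
def IsWord (b : ℤ) (l : List ℤ) : Prop := ∀ x ∈ l, x = b ∨ x = b + 1

theorem IsWord.nil (b : ℤ) : IsWord b [] := by simp [IsWord]

theorem isWord_cons {b x : ℤ} {l : List ℤ} :
    IsWord b (x :: l) ↔ (x = b ∨ x = b + 1) ∧ IsWord b l := by simp [IsWord]

theorem isWord_append {b : ℤ} {l m : List ℤ} :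
    IsWord b (l ++ m) ↔ IsWord b l ∧ IsWord b m := by
  simp only [IsWord, List.mem_append]
  exact ⟨fun h => ⟨fun x hx => h x (Or.inl hx), fun x hx => h x (Or.inr hx)⟩,
    fun h x hx => hx.elim (h.1 x) (h.2 x)⟩

theorem IsWord.climb {b : ℤ} {l : List ℤ} (h : IsWord b l) : Climb l := by
  induction l with
  | nil => simp
  | cons x l ih =>
    rw [isWord_cons] at h
    rw [Climb, List.isChain_cons]
    refine ⟨fun y hy => ?_, ih h.2⟩
    have := h.2 y (List.mem_of_mem_head? hy)
    omega

/-- For every letter `1` of a binary word, `z` plus the number of zeros in front of it. -/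
def heights : ℕ → List ℤ → Multiset ℕ
  | _, [] => 0
  | z, x :: l => if x = 0 then heights (z + 1) l else z ::ₘ heights z l

/-- The word `0 1^(m (z + 1)) ⋯ 0 1^(m (z + n))` for a multiset with multiplicities `m`. -/
def blockWord (s : Multiset ℕ) (z n : ℕ) : List ℤ :=
  (List.range n).flatMap fun i => 0 :: List.replicate (s.count (z + i + 1)) 1

theorem blockWord_succ (s : Multiset ℕ) (z n : ℕ) :
    blockWord s z (n + 1) =
      0 :: (List.replicate (s.count (z + 1)) 1 ++ blockWord s (z + 1) n) := by
  rw [blockWord, List.range_succ_eq_map, List.flatMap_cons, List.flatMap_map]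
  simp only [add_zero, List.cons_append, Nat.succ_eq_add_one, blockWord]
  congr 3
  funext i
  rw [show z + (i + 1) + 1 = z + 1 + i + 1 by ring]

theorem bWord_eq_blockWord (la : Ptn) : bWord la = blockWord la.parts 0 la.largest := by
  simp [bWord, blockWord]

theorem le_of_mem_heights {z x : ℕ} {l : List ℤ} (h : x ∈ heights z l) : z ≤ x := by
  induction l generalizing z with
  | nil => simp [heights] at h
  | cons y l ih =>
    rw [heights] at h
    split_ifs at h
    · have := ih h
      omega
    · rcases Multiset.mem_cons.mp h with rfl | h
      · rfl
      · exact ih h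

theorem heights_le {z x : ℕ} {l : List ℤ} (h : x ∈ heights z l) : x ≤ z + l.count 0 := by
  induction l generalizing z with
  | nil => simp [heights] at h
  | cons y l ih =>
    rw [heights] at h
    split_ifs at h with hy
    · have := ih h
      simp [hy]
      omega
    · rw [List.count_cons_of_ne hy]
      rcases Multiset.mem_cons.mp h with rfl | h
      · omega
      · exact ih h

theorem heights_last {z : ℕ} (l : List ℤ) :
    z + l.count 0 ∈ heights z (l ++ [1]) := by
  induction l generalizing z with
  | nil => simp [heights]
  | cons y l ih =>
    rw [List.cons_append, heights]
    split_ifs with hy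
    · have := ih (z := z + 1)
      rw [hy, List.count_cons_self]
      convert this using 1
      ring
    · rw [List.count_cons_of_ne hy]
      exact Multiset.mem_cons_of_mem ih

theorem blockWord_congr {s t : Multiset ℕ} {z n : ℕ}
    (h : ∀ x, z < x → s.count x = t.count x) : blockWord s z n = blockWord t z n := by
  unfold blockWord
  congr 1
  funext i
  rw [h _ (by omega)]

/-- The word is the boundary path of a Ferrers diagram, with `heights` giving the row lengths. Ones
before the first zero have height z and form the extra factor. -/
theorem eq_blockWord_heights {l : List ℤ} (h : IsWord 0 l) (z : ℕ) :
    l = List.replicate ((heights z l).count z) 1 ++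
      blockWord (heights z l) z (l.count 0) := by
  induction l generalizing z with
  | nil => simp [heights, blockWord]
  | cons x l ih =>
    rw [isWord_cons] at h
    rcases h.1 with rfl | rfl
    · have hz : (heights (z + 1) l).count z = 0 := by
        rw [Multiset.count_eq_zero]
        intro hm
        have := le_of_mem_heights hm
        omega
      rw [heights, if_pos rfl, hz, List.count_cons_self, blockWord_succ, ← ih h.2 (z + 1)]
      rfl
    · rw [heights, if_neg (by norm_num), List.count_cons_of_ne (by norm_num),
        Multiset.count_cons_self, List.replicate_succ, List.cons_append,
        blockWord_congr (t := heights z l), ← ih h.2 z]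
      · norm_num
      · intro x hx
        rw [Multiset.count_cons_of_ne hx.ne']

theorem heights_replicate_one_append (z c : ℕ) (l : List ℤ) :
    heights z (List.replicate c 1 ++ l) = Multiset.replicate c z + heights z l := by
  induction c with
  | zero => simp
  | succ c ih =>
    rw [List.replicate_succ, List.cons_append, heights, if_neg one_ne_zero, ih,
      Multiset.replicate_succ, Multiset.cons_add]

theorem count_heights_blockWord (s : Multiset ℕ) (z n x : ℕ) :
    (heights z (blockWord s z n)).count x = if z < x ∧ x ≤ z + n then s.count x else 0 := by
  induction n generalizing z with
  | zero =>
    rw [if_neg (by omega)]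
    simp [blockWord, heights]
  | succ n ih =>
    rw [blockWord_succ, heights, if_pos rfl, heights_replicate_one_append, Multiset.count_add, ih,
      Multiset.count_replicate]
    by_cases h1 : z + 1 = x
    · subst h1
      simp
    · rw [if_neg h1, zero_add]
      congr 1
      apply propext
      omega

theorem heights_bWord (la : Ptn) : heights 0 (bWord la) = la.parts := by
  ext x
  rw [bWord_eq_blockWord, count_heights_blockWord]
  split_ifs with h
  · rfl
  · symm
    rw [Multiset.count_eq_zero]
    intro hx
    have := Ptn.parts_pos hx
    have := Ptn.le_largest hx
    omega

theorem bWord_injective : Function.Injective bWord := fun la mu h => by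
  apply Ptn.ext_parts
  rw [← heights_bWord, h, heights_bWord]

theorem isWord_bWord (la : Ptn) : IsWord 0 (bWord la) := by
  intro x hx
  simp only [bWord, List.mem_flatMap, List.mem_cons, List.mem_replicate] at hx
  obtain ⟨i, -, h | ⟨-, h⟩⟩ := hx <;> simp [h]

theorem count_zero_bWord (la : Ptn) : (bWord la).count 0 = la.largest := by
  have : ∀ s z n, (blockWord s z n).count 0 = n := by
    intro s z n
    induction n generalizing z with
    | zero => simp [blockWord]
    | succ n ih => simp [blockWord_succ, ih, List.count_replicate]
  rw [bWord_eq_blockWord, this]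

theorem card_heights {l : List ℤ} (h : IsWord 0 l) (z : ℕ) :
    (heights z l).card = l.count 1 := by
  induction l generalizing z with
  | nil => simp [heights]
  | cons x l ih =>
    rw [isWord_cons] at h
    rcases h.1 with rfl | rfl
    · simp [heights, ih h.2]
    · simp [heights, ih h.2]

theorem count_one_bWord (la : Ptn) : (bWord la).count 1 = la.len := by
  rw [← card_heights (isWord_bWord la) 0, heights_bWord, Ptn.len]

theorem Ptn.exists_largest_mem {la : Ptn} (h : la.largest ≠ 0) : la.largest ∈ la.parts := by
  have : ∀ s : Multiset ℕ, s.sup ≠ 0 → s.sup ∈ s := by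
    intro s
    induction s using Multiset.induction_on with
    | empty => simp
    | cons a s ih =>
      intro h
      rw [Multiset.sup_cons] at h ⊢
      rcases le_total s.sup a with h1 | h1
      · simp [sup_of_le_left h1]
      · rw [sup_of_le_right h1] at h ⊢
        exact Multiset.mem_cons_of_mem (ih h)
  exact this _ h

theorem bWord_eq (la : Ptn) : bWord la = [] ∨ ∃ W, bWord la = 0 :: (W ++ [1]) := by
  by_cases h : la.largest = 0
  · left
    simp [bWord, h]
  · right
    obtain ⟨r, hr⟩ := Nat.exists_eq_succ_of_ne_zero h
    have hc : la.parts.count (r + 1) ≠ 0 := by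
      have h' := Ptn.exists_largest_mem h
      rw [hr] at h'
      rw [Multiset.count_ne_zero]
      exact h'
    obtain ⟨c, hc'⟩ := Nat.exists_eq_succ_of_ne_zero hc
    have hlast : ∃ W, bWord la = W ++ [1] := by
      refine ⟨((List.range r).flatMap fun i => 0 :: List.replicate (la.parts.count (i + 1)) 1) ++
        0 :: List.replicate c 1, ?_⟩
      rw [bWord, hr, List.range_succ, List.flatMap_append]
      simp [hc', List.replicate_succ']
    obtain ⟨W, hW⟩ := hlast
    have hb := bWord_eq_blockWord la
    rw [hr, blockWord_succ, hW] at hb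
    rcases W with _ | ⟨w, W⟩
    · simp at hb
    · rw [List.cons_append, List.cons.injEq] at hb
      exact ⟨W, by rw [hW, hb.1]; rfl⟩

theorem heights_pos {l : List ℤ} {z : ℕ} : ∀ x ∈ heights (z + 1) l, x ≠ 0 := by
  intro x hx
  have := le_of_mem_heights hx
  omega

/-- The initial 0 excludes parts of size 0, and the final 1 makes the number of zeros the largest
part; these are the only constraints on a B-word. -/
theorem exists_bWord {U : List ℤ} (h : IsWord 0 (U ++ [1])) :
    ∃ mu : Ptn, bWord mu = 0 :: (U ++ [1]) ∧ mu.size = (heights 1 (U ++ [1])).sum := by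
  refine ⟨Ptn.ofMultiset (heights 1 (U ++ [1])), ?_, rfl⟩
  have hp : (Ptn.ofMultiset (heights 1 (U ++ [1]))).parts = heights 1 (U ++ [1]) := by
    rw [Ptn.parts_ofMultiset, Multiset.filter_eq_self]
    exact heights_pos
  have hl : (Ptn.ofMultiset (heights 1 (U ++ [1]))).largest = 1 + U.count 0 := by
    rw [Ptn.largest, hp]
    apply le_antisymm
    · rw [Multiset.sup_le]
      intro b hb
      have := heights_le hb
      simpa using this
    · exact Multiset.le_sup (heights_last U)
  have := eq_blockWord_heights (l := 0 :: (U ++ [1])) (isWord_cons.mpr ⟨Or.inl rfl, h⟩) 0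
  rw [bWord_eq_blockWord, hp, hl]
  have h0 : (heights 1 (U ++ [1])).count 0 = 0 := by
    rw [Multiset.count_eq_zero]
    exact fun h => heights_pos _ h rfl
  rw [heights, if_pos rfl, zero_add, h0, List.replicate_zero, List.nil_append] at this
  rw [this]
  congr 1
  simp [add_comm]

/-! ### The deficit of a vector -/

/-- The number of letters `y` of `l` with `x - y` different from `0` and `1`. -/
def cnt (x : ℤ) (l : List ℤ) : ℤ := (l.countP fun y => decide (x - y ≠ 0 ∧ x - y ≠ 1) : ℕ)

/-- The deficit statistic: the number of pairs `i < j` with `vᵢ - vⱼ ∉ {0, 1}`, minus the sum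
of the letters. -/
def deficit : List ℤ → ℤ
  | [] => 0
  | x :: l => cnt x l - x + deficit l

theorem cnt_nil (x : ℤ) : cnt x [] = 0 := rfl

theorem cnt_cons (x y : ℤ) (l : List ℤ) :
    cnt x (y :: l) = cnt x l + if x - y ≠ 0 ∧ x - y ≠ 1 then 1 else 0 := by
  simp only [cnt, List.countP_cons]
  push_cast
  simp

theorem cnt_append (x : ℤ) (l m : List ℤ) : cnt x (l ++ m) = cnt x l + cnt x m := by
  simp [cnt]

theorem cnt_map_succ (x : ℤ) (l : List ℤ) : cnt (x + 1) (l.map (fun y => y + 1)) = cnt x l := by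
  induction l with
  | nil => rfl
  | cons y l ih => simp [cnt_cons, ih]

/-- The number of pairs `(x, y)` from two lists with `x - y` different from `0` and `1`. -/
def cross (l m : List ℤ) : ℤ := (l.map fun x => cnt x m).sum

theorem deficit_append (l m : List ℤ) :
    deficit (l ++ m) = deficit l + deficit m + cross l m := by
  induction l with
  | nil => simp [deficit, cross]
  | cons x l ih =>
    simp only [List.cons_append, deficit, ih, cnt_append, cross, List.map_cons, List.sum_cons]
    ring

theorem cross_append_left (l l' m : List ℤ) : cross (l ++ l') m = cross l m + cross l' m := by
  simp [cross]

theorem cross_append_right (l m m' : List ℤ) : cross l (m ++ m') = cross l m + cross l m' := by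
  simp [cross, cnt_append, List.sum_map_add]

theorem cross_singleton_left (x : ℤ) (m : List ℤ) : cross [x] m = cnt x m := by
  simp [cross]

theorem cross_cons_right (l m : List ℤ) (y : ℤ) : cross l (y :: m) = cross l [y] + cross l m := by
  rw [← cross_append_right]
  rfl

theorem deficit_map_succ (l : List ℤ) :
    deficit (l.map (fun y => y + 1)) = deficit l - l.length := by
  induction l with
  | nil => rfl
  | cons x l ih =>
    simp only [List.map_cons, deficit, cnt_map_succ, ih, List.length_cons]
    push_cast
    ring

section Ternary

variable {l : List ℤ} (h : ∀ x ∈ l, x = 0 ∨ x = 1 ∨ x = 2)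
include h

theorem cnt_zero : cnt 0 l = l.count 1 + l.count 2 := by
  induction l with
  | nil => rfl
  | cons y l ih =>
    simp only [List.mem_cons, forall_eq_or_imp] at h
    rcases h.1 with rfl | rfl | rfl <;> simp [cnt_cons, ih h.2] <;> ring

theorem cnt_one : cnt 1 l = l.count 2 := by
  induction l with
  | nil => rfl
  | cons y l ih =>
    simp only [List.mem_cons, forall_eq_or_imp] at h
    rcases h.1 with rfl | rfl | rfl <;> simp [cnt_cons, ih h.2]

theorem cnt_two : cnt 2 l = l.count 0 := by
  induction l with
  | nil => rfl
  | cons y l ih =>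
    simp only [List.mem_cons, forall_eq_or_imp] at h
    rcases h.1 with rfl | rfl | rfl <;> simp [cnt_cons, ih h.2]

theorem cross_zero : cross l [0] = l.count 2 := by
  induction l with
  | nil => rfl
  | cons y l ih =>
    simp only [List.mem_cons, forall_eq_or_imp] at h
    have := ih h.2
    rcases h.1 with rfl | rfl | rfl <;> simp_all [cross, cnt_cons, cnt_nil]; ring

theorem cross_one : cross l [1] = l.count 0 := by
  induction l with
  | nil => rfl
  | cons y l ih =>
    simp only [List.mem_cons, forall_eq_or_imp] at h
    have := ih h.2
    rcases h.1 with rfl | rfl | rfl <;> simp_all [cross, cnt_cons, cnt_nil]; ring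

end Ternary

theorem IsWord.ternary {l : List ℤ} (h : IsWord 0 l ∨ IsWord 1 l) :
    ∀ x ∈ l, x = 0 ∨ x = 1 ∨ x = 2 := by
  intro x hx
  rcases h with h | h
  · have := h x hx
    omega
  · have := h x hx
    omega

theorem IsWord.count_eq_zero {b x : ℤ} {l : List ℤ} (h : IsWord b l) (h1 : x ≠ b)
    (h2 : x ≠ b + 1) : l.count x = 0 := by
  rw [List.count_eq_zero]
  intro hx
  rcases h x hx with h | h <;> contradiction

theorem ternary_append {P T : List ℤ} (hP : IsWord 1 P) (hT : IsWord 0 T) :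
    ∀ x ∈ P ++ T, x = 0 ∨ x = 1 ∨ x = 2 := by
  intro x hx
  rcases List.mem_append.mp hx with hx | hx
  · exact IsWord.ternary (Or.inr hP) x hx
  · exact IsWord.ternary (Or.inl hT) x hx

/-- This and the next two identities match the deficit across the three moves of the iteration: one
rotation cycle and the two NU₂ rules. They are stated at vectors starting with 0 0, where no -1
occurs and counting the letters 0, 1, 2 is enough. -/
theorem deficit_rotate {P T : List ℤ} (hP : IsWord 1 P) (hT : IsWord 0 T) :
    deficit (0 :: 0 :: 1 :: 1 :: (P ++ T)) =
      deficit (0 :: 0 :: 1 :: ((P ++ [1]) ++ (T ++ [0]))) := by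
  have h1 := IsWord.ternary (Or.inr hP)
  have h2 := IsWord.ternary (Or.inl hT)
  simp only [deficit, deficit_append, cnt_cons, cnt_append, cnt_nil, cnt_zero h1, cnt_zero h2,
    cnt_one h1, cnt_one h2, cross_append_left, cross_append_right,
    cross_one h1, cross_zero h1, cross_zero h2,
    hP.count_eq_zero (x := 0) (by norm_num) (by norm_num),
    hT.count_eq_zero (x := 2) (by norm_num) (by norm_num), cross_singleton_left]
  norm_num
  ring

theorem deficit_ruleA {A : List ℤ} (h : ∀ x ∈ A, x = 0 ∨ x = 1 ∨ x = 2) :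
    deficit (0 :: 0 :: 1 :: 2 :: 2 :: A) = deficit (0 :: 0 :: 1 :: (A ++ [1, 1])) := by
  simp only [deficit, deficit_append, cnt_cons, cnt_append, cnt_nil, cnt_zero h, cnt_one h,
    cnt_two h, cross_cons_right A [1] 1, cross_one h]
  norm_num
  ring

theorem deficit_ruleB {B : List ℤ} (h : ∀ x ∈ B, x = 0 ∨ x = 1 ∨ x = 2) :
    deficit (0 :: 0 :: 1 :: 2 :: B) = deficit (0 :: 0 :: (B ++ [0, 1])) := by
  simp only [deficit, deficit_append, cnt_cons, cnt_append, cnt_nil, cnt_zero h, cnt_one h,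
    cnt_two h, cross_cons_right B [1] 0, cross_one h, cross_zero h]
  norm_num
  ring

theorem sum_heights_succ {l : List ℤ} (h : IsWord 0 l) (z : ℕ) :
    (heights (z + 1) l).sum = (heights z l).sum + l.count 1 := by
  induction l generalizing z with
  | nil => rfl
  | cons x l ih =>
    rw [isWord_cons] at h
    rcases h.1 with rfl | rfl
    · simp [heights, ih h.2]
    · simp [heights, ih h.2]
      ring

theorem deficit_binary {l : List ℤ} (h : IsWord 0 l) :
    deficit l = (heights 0 l).sum - l.count 1 := by
  induction l with
  | nil => rfl
  | cons x l ih =>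
    rw [isWord_cons] at h
    have ht := IsWord.ternary (Or.inl h.2)
    have h2 := h.2.count_eq_zero (x := 2) (by norm_num) (by norm_num)
    rcases h.1 with rfl | rfl
    · rw [deficit, ih h.2, cnt_zero ht, h2, heights, if_pos rfl, sum_heights_succ h.2]
      simp
    · rw [deficit, ih h.2]
      norm_num [cnt_one ht, h2, heights]
      ring

/-- The end of the iteration: the right side is the size of the partition given by `exists_bWord`.
-/
theorem deficit_zero_zero {U : List ℤ} (h : IsWord 0 U) :
    deficit (0 :: 0 :: U) = (heights 1 U).sum := by
  have ht := IsWord.ternary (Or.inl h)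
  have h2 := h.count_eq_zero (x := 2) (by norm_num) (by norm_num)
  have := sum_heights_succ h 0
  rw [zero_add] at this
  simp [deficit, cnt_cons, cnt_zero ht, h2, deficit_binary h, this, add_comm]

/-! ### Iterating the next-up map -/

/-- The class of a vector, shifted so that its first entry becomes zero. -/
def cl (v : List ℤ) : Ptn := dyckClass (v.map fun x => x - v.headI)

theorem cl_zero_cons (R : List ℤ) : cl (0 :: R) = dyckClass (0 :: R) := by
  simp [cl]

theorem cl_map_succ (v : List ℤ) : cl (v.map (fun x => x + 1)) = cl v := by
  rcases v with _ | ⟨x, v⟩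
  · rfl
  · simp [cl, Function.comp_def]

theorem cl_cons_succ (x : ℤ) (R : List ℤ) : cl (x :: (x + 1) :: R) = cl ((x + 1) :: R) := by
  have h := dyckClass_shift (((x + 1) :: R).map fun y => y - (x + 1))
  rw [cl, cl, List.headI_cons, List.headI_cons, ← h]
  congr 1
  simp
  intros
  ring

/-- Raising R by one lowers every part by one, and the appended 0 at position ℓ + 1 supplies the new
part ℓ + 1. The bound on the last letter encodes γ₁ ≤ ℓ + 2. -/
theorem NU1_dyckClass {R : List ℤ} (hc : Climb R) (hh : ∀ y ∈ R.head?, y ≤ 0)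
    (hl : ∀ z ∈ R.getLast?, -2 ≤ z) :
    NU1 (dyckClass (0 :: R)) (dyckClass (0 :: (R.map (fun x => x + 1) ++ [0]))) := by
  have hp := parts_dyckClass_reduced hc hh
  have hlen : (dyckClass (0 :: R)).len = R.length := by
    rw [Ptn.len, hp, Multiset.coe_card, length_gaps]
  refine ⟨?_, ?_⟩
  · rw [hlen, Ptn.largest, Multiset.sup_le, hp]
    intro b hb
    rcases List.eq_nil_or_concat R with rfl | ⟨R', z, rfl⟩
    · simp [gaps] at hb
    · have hz := hl z (by simp)
      have := gaps_le hc (z := z) (by simp) b (by simpa using hb)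
      omega
  · apply Ptn.ext_parts
    rw [parts_dyckClass_zero, Ptn.parts_ofMultiset, hlen, hp, gaps_append, gaps_map_succ,
      Multiset.map_coe]
    congr 1
    rw [Multiset.cons_coe, Multiset.coe_eq_coe, List.length_map]
    have : gaps (1 + (R.length : ℤ)) [0] = [R.length + 1] := by
      simp [gaps]
      omega
    rw [this]
    exact List.perm_append_comm

/-- `w` is reached from the quasi-Dyck vector `v` by iterating `NU`. -/
def Reach (v w : List ℤ) : Prop :=
  Climb v → Climb w ∧ Relation.ReflTransGen NU (cl v) (cl w)

theorem Reach.trans {u v w : List ℤ} (h : Reach u v) (h' : Reach v w) : Reach u w := fun hc =>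
  ⟨(h' (h hc).1).1, (h hc).2.trans (h' (h hc).1).2⟩

/-- NU₁ without normalising the first entry: R stays fixed, so iterating becomes moving letters from
front to back. -/
theorem reach_drop {x : ℤ} {R : List ℤ} (hh : ∀ y ∈ R.head?, y ≤ x)
    (hl : ∀ z ∈ R.getLast?, x - 2 ≤ z) : Reach (x :: R) ((x - 1) :: (R ++ [x - 1])) := by
  intro hc
  rw [Climb, List.isChain_cons] at hc
  constructor
  · rw [Climb, List.isChain_cons, List.isChain_append]
    refine ⟨?_, hc.2, by simp, ?_⟩
    · rcases R with _ | ⟨y, R⟩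
      · simp
      · simpa using hh
    · intro z hz y hy
      have := hl z hz
      simp at hy
      omega
  · apply Relation.ReflTransGen.single
    left
    have h1 : Climb (R.map fun y => y - x) := by
      rw [Climb, List.isChain_map]
      exact hc.2.imp fun a b h => by omega
    convert NU1_dyckClass h1 ?_ ?_ using 1
    · simp [cl]
    · simp only [cl, List.map_cons, List.headI_cons, List.map_append, List.map_map, List.map_nil,
        sub_self, Function.comp_def]
      congr 5
      funext y
      ring
    · intro y hy
      rw [List.head?_map] at hy
      obtain ⟨w, hw, rfl⟩ := Option.map_eq_some_iff.mp hy
      have := hh w hw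
      omega
    · intro y hy
      rw [List.getLast?_map] at hy
      obtain ⟨w, hw, rfl⟩ := Option.map_eq_some_iff.mp hy
      have := hl w hw
      omega

theorem reach_cons_succ (x : ℤ) (R : List ℤ) : Reach (x :: (x + 1) :: R) ((x + 1) :: R) :=
  fun hc => ⟨hc.tail, by rw [cl_cons_succ]⟩

theorem reach_map_succ (v : List ℤ) : Reach v (v.map (fun x => x + 1)) := fun hc =>
  ⟨by rw [Climb, List.isChain_map]; exact hc.imp fun a b h => by omega, by rw [cl_map_succ]⟩

/-- Letters `b` and `b + 1` at the front move to the end and are decreased by one. -/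
theorem reach_rotate {b : ℤ} {Y W : List ℤ} (hY : IsWord b Y) (hW : W ≠ [])
    (hh : ∀ y ∈ W.head?, y ≤ b + 1) (hl : ∀ z ∈ W.getLast?, b - 1 ≤ z) :
    Reach (b :: (Y ++ W)) (b :: (W ++ Y.map (fun x => x - 1))) := by
  induction Y generalizing W with
  | nil => intro h; simpa using ⟨h, Relation.ReflTransGen.refl⟩
  | cons y Y ih =>
    rw [isWord_cons] at hY
    have key : Reach (b :: (y :: Y ++ W)) (b :: (Y ++ (W ++ [y - 1]))) := by
      have hl' : ∀ z ∈ (y :: (Y ++ W)).getLast?, b - 1 ≤ z := by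
        intro z hz
        refine hl z ?_
        rw [← List.cons_append, List.getLast?_append_of_ne_nil _ hW] at hz
        exact hz
      -- A letter b is passed by dropping and then deleting the redundant b - 1 in front; for b + 1
      -- the deletion comes before the drop.
      rcases hY.1 with rfl | rfl
      · refine (reach_drop (by simp) fun z hz => ?_).trans ?_
        · have := hl' z hz
          omega
        · have := reach_cons_succ (y - 1) ((Y ++ W) ++ [y - 1])
          simpa using this
      · refine (reach_cons_succ b (Y ++ W)).trans ?_
        have := reach_drop (x := b + 1) (R := Y ++ W) ?_ ?_
        · simpa using this
        · intro w hw
          rw [List.head?_append] at hw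
          rcases Y with _ | ⟨v, Y⟩
          · exact hh w (by simpa using hw)
          · simp at hw
            have := hY.2 v (by simp)
            omega
        · intro z hz
          rw [List.getLast?_append_of_ne_nil _ hW] at hz
          have := hl z hz
          omega
    refine key.trans ?_
    have := ih (W := W ++ [y - 1]) hY.2 (by simp) ?_ ?_
    · simpa using this
    · intro w hw
      rw [List.head?_append_of_ne_nil _ hW] at hw
      exact hh w hw
    · intro z hz
      simp at hz
      omega

theorem IsWord.map_pred {b : ℤ} {l : List ℤ} (h : IsWord b l) :
    IsWord (b - 1) (l.map fun x => x - 1) := by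
  intro x hx
  obtain ⟨y, hy, rfl⟩ := List.mem_map.mp hx
  have := h y hy
  omega

theorem IsWord.getLast_append {b : ℤ} {l m : List ℤ} (h : IsWord b l) {z : ℤ}
    (hz : z ∈ (m ++ l).getLast?) : b ≤ z ∨ z ∈ m.getLast? := by
  rw [List.getLast?_append, Option.mem_def, Option.or_eq_some_iff] at hz
  rcases hz with hz | hz
  · left
    have := h z (List.mem_of_getLast? hz)
    omega
  · exact Or.inr hz.2

theorem IsWord.head_append {b : ℤ} {l m : List ℤ} (h : IsWord b l) {z : ℤ}
    (hz : z ∈ (l ++ m).head?) : z ≤ b + 1 ∨ z ∈ m.head? := by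
  rw [List.head?_append, Option.mem_def, Option.or_eq_some_iff] at hz
  rcases hz with hz | hz
  · left
    have := h z (List.mem_of_head? hz)
    omega
  · exact Or.inr hz.2

/-- One full pass moves a leading 1 behind P and adds a 0 to T. Repeating it brings the first 2 next
to a single 1, where NU₂ applies. -/
theorem reach_cycle {P T : List ℤ} (hP : IsWord 1 P) (hT : IsWord 0 T) :
    Reach (0 :: 1 :: 1 :: (P ++ (T ++ [-1])))
      (0 :: 1 :: ((P ++ [1]) ++ ((T ++ [0]) ++ [-1]))) := by
  set P' := P.map (fun x => x - 1) with hP'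
  set T' := T.map (fun x => x - 1) with hT'
  have wP : IsWord 0 P' := hP.map_pred
  have wT : IsWord (-1) T' := hT.map_pred
  have h1 : Reach (0 :: 1 :: 1 :: (P ++ (T ++ [-1]))) (1 :: 1 :: (P ++ (T ++ [-1]))) :=
    reach_cons_succ 0 _
  have h2 : Reach (1 :: 1 :: (P ++ (T ++ [-1]))) (0 :: 1 :: (P ++ (T ++ [-1, 0]))) := by
    have := reach_drop (x := 1) (R := 1 :: (P ++ (T ++ [-1]))) (by simp)
      (by simp [List.getLast?_cons])
    simpa using this
  have h3 : Reach (0 :: 1 :: (P ++ (T ++ [-1, 0]))) (1 :: (P ++ (T ++ [-1, 0]))) :=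
    reach_cons_succ 0 _
  have h4 : Reach (1 :: (P ++ (T ++ [-1, 0]))) (1 :: (T ++ [-1, 0] ++ P')) := by
    refine reach_rotate hP (by simp) (fun y hy => ?_) (by simp)
    rcases hT.head_append hy with h | h
    · omega
    · simp at h
      omega
  have h5 : Reach (1 :: (T ++ [-1, 0] ++ P')) (0 :: (T ++ ([-1, 0] ++ P' ++ [0]))) := by
    have := reach_drop (x := 1) (R := T ++ ([-1, 0] ++ P')) (fun y hy => ?_) (fun z hz => ?_)
    · simpa using this
    · rcases hT.head_append hy with h | h
      · omega
      · simp at h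
        omega
    · rw [← List.append_assoc] at hz
      rcases wP.getLast_append hz with h | h
      · omega
      · simp at h
        omega
  have h6 : Reach (0 :: (T ++ ([-1, 0] ++ P' ++ [0]))) (0 :: ([-1, 0] ++ P' ++ [0] ++ T')) :=
    reach_rotate hT (by simp) (by simp) (by simp [List.getLast?_cons])
  have h7 : Reach (0 :: ([-1, 0] ++ P' ++ [0] ++ T'))
      (-1 :: ([-1, 0] ++ P' ++ [0] ++ T' ++ [-1])) := by
    refine reach_drop (x := 0) (by simp) fun z hz => ?_
    rcases wT.getLast_append hz with h | h
    · omega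
    · simp [List.getLast?_cons] at h
      omega
  have h8 : Reach (-1 :: ([-1, 0] ++ P' ++ [0] ++ T' ++ [-1]))
      (-2 :: -1 :: 0 :: (P' ++ [0] ++ T' ++ [-1, -2])) := by
    have := reach_drop (x := -1) (R := [-1, 0] ++ P' ++ [0] ++ T' ++ [-1]) (by simp)
      (by simp [List.getLast?_cons])
    simpa using this
  have h9 : Reach (-2 :: -1 :: 0 :: (P' ++ [0] ++ T' ++ [-1, -2]))
      (-1 :: 0 :: (P' ++ [0] ++ T' ++ [-1, -2])) := reach_cons_succ (-2) _
  -- During the pass each letter of P and T was lowered by one; this shift restores them.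
  have h10 := reach_map_succ (-1 :: 0 :: (P' ++ [0] ++ T' ++ [-1, -2]))
  have e : ((-1 : ℤ) :: 0 :: (P' ++ [0] ++ T' ++ [-1, -2])).map (fun x => x + 1) =
      0 :: 1 :: ((P ++ [1]) ++ ((T ++ [0]) ++ [-1])) := by
    simp [hP', hT', Function.comp_def]
  rw [e] at h10
  exact h1.trans (h2.trans (h3.trans (h4.trans (h5.trans (h6.trans (h7.trans (h8.trans
    (h9.trans h10))))))))

/-- The iteration from `v` ends in a tail initiator of a partition of size `n`. -/
def EndsInTail (v : List ℤ) (n : ℤ) : Prop :=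
  ∃ mu : Ptn, Relation.ReflTransGen NU (cl v) (TI mu) ∧ mu.size = n

theorem EndsInTail.of_reach {v w : List ℤ} {n : ℤ} (hv : Climb v) (h : Reach v w)
    (hw : EndsInTail w n) : EndsInTail v n := by
  obtain ⟨mu, h1, h2⟩ := hw
  exact ⟨mu, (h hv).2.trans h1, h2⟩

/-! ### Arrival at a tail initiator, by induction on the number of 2s -/

theorem climb_zero_append {P T : List ℤ} (hP : IsWord 1 P) (hT : IsWord 0 T)
    (hh : ∀ x ∈ P.head?, x = 1) : Climb (0 :: (P ++ T)) := by
  rw [Climb, List.isChain_cons, List.isChain_append]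
  refine ⟨fun y hy => ?_, hP.climb, hT.climb, fun x hx y hy => ?_⟩
  · rw [List.head?_append, Option.mem_def, Option.or_eq_some_iff] at hy
    rcases hy with hy | hy
    · simp [hh y hy]
    · have := hT y (List.mem_of_head? hy.2)
      omega
  · have := hP x (List.mem_of_getLast? hx)
    have := hT y (List.mem_of_head? hy)
    omega

theorem climb_zero_append_neg_one {P T : List ℤ} (hP : IsWord 1 P) (hT : IsWord 0 T)
    (hh : ∀ x ∈ P.head?, x = 1) : Climb (0 :: (P ++ (T ++ [-1]))) := by
  have h := climb_zero_append hP hT hh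
  have e : 0 :: (P ++ (T ++ [-1])) = (0 :: (P ++ T)) ++ [-1] := by simp
  rw [e, Climb, List.isChain_append]
  refine ⟨h, by simp, fun x hx y hy => ?_⟩
  have hx' := List.mem_of_getLast? hx
  simp only [List.mem_cons, List.mem_append] at hx'
  simp at hy
  rcases hx' with rfl | hx' | hx'
  · omega
  · have := hP x hx'
    omega
  · have := hT x hx'
    omega

theorem exists_replicate_two {P : List ℤ} (hP : IsWord 1 P) (h : P.count 2 ≠ 0) :
    ∃ i Z, P = List.replicate i 1 ++ 2 :: Z := by
  induction P with
  | nil => simp at h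
  | cons x P ih =>
    rw [isWord_cons] at hP
    rcases hP.1 with rfl | rfl
    · obtain ⟨i, Z, rfl⟩ := ih hP.2 (by simpa using h)
      exact ⟨i + 1, Z, by simp [List.replicate_succ]⟩
    · exact ⟨0, P, by simp⟩

theorem isWord_replicate (b : ℤ) (n : ℕ) : IsWord b (List.replicate n b) := fun _ hx =>
  Or.inl (List.eq_of_mem_replicate hx)

theorem endsInTail_of_no_two {P T : List ℤ} (hP : IsWord 1 P) (hT : IsWord 0 (T ++ [1]))
    (h : P.count 2 = 0) :
    EndsInTail (0 :: 0 :: (P ++ (T ++ [1]))) (deficit (0 :: 0 :: (P ++ (T ++ [1])))) := by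
  have hP' : IsWord 0 P := by
    intro x hx
    rcases hP x hx with h1 | h1
    · right
      omega
    · obtain rfl : x = 2 := h1
      exact absurd hx (List.count_eq_zero.mp h)
  have hw : IsWord 0 (P ++ T ++ [1]) := by
    rw [List.append_assoc, isWord_append]
    exact ⟨hP', hT⟩
  obtain ⟨mu, h1, h2⟩ := exists_bWord hw
  rw [← List.append_assoc]
  refine ⟨mu, ?_, ?_⟩
  · rw [TI, h1, cl_zero_cons]
  · rw [deficit_zero_zero hw, h2]

/-- The outer induction is on the number n of 2s, the inner one on the surplus i of ones before the
first 2; each `reach_cycle` lowers i. -/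
theorem endsInTail_of_two (n : ℕ)
    (ih : ∀ P T : List ℤ, IsWord 1 P → IsWord 0 (T ++ [1]) → (∀ x ∈ P.head?, x = 1) →
      P.count 2 < n → EndsInTail (0 :: 0 :: (P ++ (T ++ [1])))
        (deficit (0 :: 0 :: (P ++ (T ++ [1]))))) (i : ℕ) :
    ∀ Z T : List ℤ, IsWord 1 Z → IsWord 0 T → Z.count 2 + 1 = n →
      EndsInTail (0 :: (List.replicate (i + 1) 1 ++ 2 :: Z ++ (T ++ [-1])))
        (deficit (0 :: 0 :: (List.replicate (i + 1) 1 ++ 2 :: Z ++ T))) := by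
  induction i with
  | zero =>
    intro Z T hZ hT hn
    -- If a second 2 follows, the first rule with h = 2 applies and removes two 2s; otherwise the
    -- second rule with exponent 1 removes one.
    rcases Z with _ | ⟨z, Z⟩
    · have := ih [] (T ++ [0]) (IsWord.nil 1)
        (by simp [isWord_append, hT, isWord_cons, IsWord.nil]) (by simp) (by simp; omega)
      have hd := deficit_ruleB (B := T) (IsWord.ternary (Or.inl hT))
      obtain ⟨mu, h1, h2⟩ := this
      refine ⟨mu, ?_, ?_⟩
      · refine Relation.ReflTransGen.head (Or.inr ?_) h1
        rw [NU2_iff]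
        refine Or.inr ⟨1, T, ⟨le_rfl, ?_, ?_, ?_, hT.climb⟩, ?_, ?_⟩
        · intro x hx
          have := hT x hx
          omega
        · intro x hx
          have := hT x (List.mem_of_head? hx)
          omega
        · intro x hx
          have := hT x (List.mem_of_getLast? hx)
          omega
        · simp [cl]
        · simp [cl, imageB]
      · rw [h2]
        simpa using hd.symm
    · rw [isWord_cons] at hZ
      rcases hZ.1 with rfl | rfl
      · have hZ' : IsWord 1 (1 :: Z) := isWord_cons.mpr ⟨Or.inl rfl, hZ.2⟩
        have := ih (1 :: Z) (T ++ [0]) hZ'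
          (by simp [isWord_append, hT, isWord_cons, IsWord.nil]) (by simp) (by omega)
        have ht := ternary_append hZ' hT
        have hd := deficit_ruleB ht
        obtain ⟨mu, h1, h2⟩ := this
        refine ⟨mu, ?_, ?_⟩
        · refine Relation.ReflTransGen.head (Or.inr ?_) h1
          rw [NU2_iff]
          refine Or.inr ⟨1, 1 :: Z ++ T, ⟨le_rfl, ?_, ?_, ?_, ?_⟩, ?_, ?_⟩
          · intro x hx
            have := ht x hx
            omega
          · simp
          · intro x hx
            have := ht x (List.mem_of_getLast? hx)
            omega
          · exact (climb_zero_append hZ' hT (by simp)).tail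
          · simp [cl]
          · simp [cl, imageB]
        · rw [h2]
          simpa using hd.symm
      · have hZ' : IsWord 1 (1 :: Z) := isWord_cons.mpr ⟨Or.inl rfl, hZ.2⟩
        have := ih (1 :: Z) (T ++ [1]) hZ'
          (by simp [isWord_append, hT, isWord_cons, IsWord.nil]) (by simp)
          (by simp at hn ⊢; omega)
        have ht := ternary_append hZ.2 hT
        have hd := deficit_ruleA ht
        obtain ⟨mu, h1, h2⟩ := this
        refine ⟨mu, ?_, ?_⟩
        · refine Relation.ReflTransGen.head (Or.inr ?_) h1
          rw [NU2_iff]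
          refine Or.inl ⟨2, Z ++ T, ⟨le_rfl, ?_, ?_, ?_⟩, ?_, ?_⟩
          · intro x hx
            have := ht x hx
            omega
          · intro x hx
            have := ht x (List.mem_of_getLast? hx)
            omega
          · exact (climb_zero_append hZ' hT (by simp)).tail.tail
          · simp [cl, List.replicate_succ]
          · simp [cl, imageA, List.replicate_succ]
        · rw [h2]
          simpa using hd.symm
  | succ i ihi =>
    intro Z T hZ hT hn
    set P := List.replicate i 1 ++ 2 :: Z with hPdef
    have hP : IsWord 1 P := isWord_append.mpr
      ⟨isWord_replicate 1 i, isWord_cons.mpr ⟨Or.inr rfl, hZ⟩⟩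
    have hP2 : IsWord 1 (1 :: 1 :: P) :=
      isWord_cons.mpr ⟨Or.inl rfl, isWord_cons.mpr ⟨Or.inl rfl, hP⟩⟩
    have hih := ihi (Z ++ [1]) (T ++ [0])
      (isWord_append.mpr ⟨hZ, isWord_cons.mpr ⟨Or.inl rfl, IsWord.nil 1⟩⟩)
      (isWord_append.mpr ⟨hT, isWord_cons.mpr ⟨Or.inl rfl, IsWord.nil 0⟩⟩) (by simpa using hn)
    have hd := deficit_rotate hP hT
    have hr := reach_cycle hP hT
    have e1 : 0 :: (List.replicate (i + 1 + 1) 1 ++ 2 :: Z ++ (T ++ [-1])) =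
        0 :: 1 :: 1 :: (P ++ (T ++ [-1])) := by
      simp [hPdef, List.replicate_succ]
    have e2 : 0 :: 0 :: (List.replicate (i + 1 + 1) 1 ++ 2 :: Z ++ T) =
        0 :: 0 :: 1 :: 1 :: (P ++ T) := by
      simp [hPdef, List.replicate_succ]
    rw [e1, e2, hd]
    refine EndsInTail.of_reach (climb_zero_append_neg_one hP2 hT (by simp)) hr ?_
    convert hih using 2 <;> simp [hPdef, List.replicate_succ]

/-- One NU₁ step passes from the form in which deficits are compared to the form on which
`reach_cycle` and NU₂ act. -/
theorem endsInTail_drop {P T : List ℤ} (hP : IsWord 1 P) (hT : IsWord 0 T)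
    (hh : ∀ x ∈ P.head?, x = 1) {n : ℤ}
    (h : EndsInTail (0 :: (P ++ (T ++ [-1]))) n) (hl : ∀ x ∈ (P ++ T).getLast?, -2 ≤ x) :
    EndsInTail (0 :: 0 :: (P ++ T)) n := by
  have h1 : Reach (0 :: 0 :: (P ++ T)) (-1 :: 0 :: (P ++ (T ++ [-1]))) := by
    have := reach_drop (x := 0) (R := 0 :: (P ++ T)) (by simp) (fun z hz => ?_)
    · simpa using this
    · rw [List.getLast?_cons] at hz
      rcases hz' : (P ++ T).getLast? with _ | w
      · simp [hz'] at hz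
        omega
      · simp only [hz', Option.getD_some, Option.mem_def, Option.some.injEq] at hz
        have := hl w hz'
        omega
  have h2 : Reach (-1 :: 0 :: (P ++ (T ++ [-1]))) (0 :: (P ++ (T ++ [-1]))) :=
    reach_cons_succ (-1) _
  refine EndsInTail.of_reach ?_ (h1.trans h2) h
  rw [Climb, List.isChain_cons]
  exact ⟨by simp, climb_zero_append hP hT hh⟩

theorem endsInTail_of_count_lt (n : ℕ) :
    ∀ P T : List ℤ, IsWord 1 P → IsWord 0 (T ++ [1]) → (∀ x ∈ P.head?, x = 1) →
      P.count 2 < n → EndsInTail (0 :: 0 :: (P ++ (T ++ [1])))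
        (deficit (0 :: 0 :: (P ++ (T ++ [1])))) := by
  induction n with
  | zero => intro P T _ _ _ h; omega
  | succ n ih =>
    intro P T hP hT hh hn
    by_cases h0 : P.count 2 = 0
    · exact endsInTail_of_no_two hP hT h0
    · obtain ⟨i, Z, rfl⟩ := exists_replicate_two hP h0
      rcases i with _ | i
      · simp at hh
      · have hZ : IsWord 1 Z := (isWord_cons.mp (isWord_append.mp hP).2).2
        have hc : Z.count 2 + 1 = (List.replicate (i + 1) 1 ++ 2 :: Z).count (2 : ℤ) := by
          simp [List.count_replicate]
        refine endsInTail_drop hP hT hh ?_ (by simp [List.getLast?_cons])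
        exact endsInTail_of_two _ (fun P T h1 h2 h3 h4 => ih P T h1 h2 h3 (by omega)) i Z _ hZ hT hc

theorem endsInTail {P : List ℤ} (hP : IsWord 1 P) (hh : ∀ x ∈ P.head?, x = 1)
    (h2 : P.count 2 ≠ 0) : EndsInTail (0 :: 0 :: P) (deficit (0 :: 0 :: P)) := by
  obtain ⟨i, Z, rfl⟩ := exists_replicate_two hP h2
  rcases i with _ | i
  · simp at hh
  · have hZ : IsWord 1 Z := (isWord_cons.mp (isWord_append.mp hP).2).2
    have := endsInTail_of_two _ (endsInTail_of_count_lt _) i Z [] hZ (IsWord.nil 0) rfl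
    have h3 := endsInTail_drop hP (IsWord.nil 0) hh this fun x hx => ?_
    · simpa using h3
    · rw [List.append_nil] at hx
      have := hP x (List.mem_of_getLast? hx)
      omega

/-! ### Flagpole vectors -/

/-- The letters `1 2^b B_λ⁺` of a flagpole vector. -/
def flagBody (la : Ptn) (b : ℕ) : List ℤ :=
  1 :: (List.replicate b 2 ++ (bWord la).map fun x => x + 1)

theorem flagVec_eq (la : Ptn) (a : ℕ) (ep : Fin 2) :
    flagVec la a ep = 0 :: 0 :: (flagBody la (a - ep.val) ++ List.replicate ep.val 1) := by
  simp [flagVec, flagBody]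

theorem IsWord.map_succ {b : ℤ} {l : List ℤ} (h : IsWord b l) :
    IsWord (b + 1) (l.map fun x => x + 1) := by
  intro x hx
  obtain ⟨y, hy, rfl⟩ := List.mem_map.mp hx
  have := h y hy
  omega

theorem isWord_flagBody (la : Ptn) (b : ℕ) : IsWord 1 (flagBody la b) := by
  refine isWord_cons.mpr ⟨Or.inl rfl, isWord_append.mpr ⟨?_, (isWord_bWord la).map_succ⟩⟩
  intro x hx
  exact Or.inr (List.eq_of_mem_replicate hx)

theorem flagBody_last (la : Ptn) {b : ℕ} (hb : b ≠ 0) : ∃ X, flagBody la b = X ++ [2] := by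
  rcases bWord_eq la with h | ⟨W, h⟩
  · obtain ⟨c, rfl⟩ := Nat.exists_eq_succ_of_ne_zero hb
    exact ⟨1 :: List.replicate c 2, by simp [flagBody, h, List.replicate_succ']⟩
  · exact ⟨1 :: (List.replicate b 2 ++ 1 :: W.map (fun x => x + 1)), by simp [flagBody, h]⟩

theorem flagBody_injective {la mu : Ptn} {b c : ℕ} (h : flagBody la b = flagBody mu c) :
    la = mu ∧ b = c := by
  -- The sentinel 3 ensures that the run of 2s is followed by another letter even when B_λ is empty.
  have key : ∀ la : Ptn, ∃ (x : ℤ) (Y : List ℤ), x ≠ 2 ∧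
      ((bWord la).map fun x => x + 1) ++ [3] = x :: Y := by
    intro la
    rcases bWord_eq la with h | ⟨W, h⟩
    · exact ⟨3, [], by norm_num, by simp [h]⟩
    · exact ⟨1, _, by norm_num, by rw [h]; rfl⟩
  obtain ⟨x, X, hx, h1⟩ := key la
  obtain ⟨y, Y, hy, h2⟩ := key mu
  have h3 : List.replicate b 2 ++ x :: X = List.replicate c 2 ++ y :: Y := by
    rw [← h1, ← h2, ← List.append_assoc, ← List.append_assoc]
    rw [flagBody, flagBody, List.cons.injEq] at h
    rw [h.2]
  obtain ⟨h4, rfl, rfl⟩ := replicate_append_cons_inj hx hy h3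
  refine ⟨bWord_injective ?_, h4⟩
  have h5 := List.append_cancel_right (h1.trans h2.symm)
  exact List.map_injective_iff.mpr (add_left_injective 1) h5

theorem isWord_one_replicate_flag (la : Ptn) (b e : ℕ) :
    IsWord 1 (flagBody la b ++ List.replicate e 1) :=
  isWord_append.mpr ⟨isWord_flagBody la b, isWord_replicate 1 e⟩

theorem climb_flag (la : Ptn) (b e : ℕ) :
    Climb (0 :: (flagBody la b ++ List.replicate e 1)) := by
  rw [Climb, List.isChain_cons]
  exact ⟨by simp [flagBody], (isWord_one_replicate_flag la b e).climb⟩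

theorem dyckClass_flagVec_injective {la mu : Ptn} {a c : ℕ} {ep de : Fin 2} (ha : 2 ≤ a)
    (hc : 2 ≤ c) (h : dyckClass (flagVec la a ep) = dyckClass (flagVec mu c de)) :
    la = mu ∧ a = c ∧ ep = de := by
  rw [flagVec_eq, flagVec_eq] at h
  have h1 := dyckClass_injective (climb_flag la _ _) (by simp) (climb_flag mu _ _) (by simp) h
  rw [List.cons.injEq] at h1
  have h2 := h1.2
  have hep : ep = de := by
    obtain ⟨X, hX⟩ := flagBody_last la (b := a - ep.val) (by omega)
    obtain ⟨Y, hY⟩ := flagBody_last mu (b := c - de.val) (by omega)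
    rw [hX, hY] at h2
    have h3 := congrArg List.getLast? h2
    fin_cases ep <;> fin_cases de <;> simp at h3 ⊢
  subst hep
  obtain ⟨h3, h4⟩ := flagBody_injective (List.append_cancel_right h2)
  exact ⟨h3, by omega, rfl⟩

/-- The last letter is positive, which excludes the image of NU₁. Representatives of NU₂-images end
in y 1 with y ≤ 1, whereas V ends in 2 or in 2 1. -/
theorem not_ND_flagVec (la : Ptn) {a : ℕ} (ep : Fin 2) (ha : 2 ≤ a) (de : Ptn) :
    ¬ ND (dyckClass (flagVec la a ep)) de := by
  obtain ⟨X, hX⟩ := flagBody_last la (b := a - ep.val) (by omega)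
  have hcl := climb_flag la (a - ep.val) ep.val
  rw [flagVec_eq]
  rintro (h | h)
  · refine absurd h.len_le (not_le.mpr ?_)
    rw [hX] at hcl ⊢
    have hep : ep = 0 ∨ ep = 1 := by omega
    rcases hep with rfl | rfl
    · exact largest_lt_len (z := 2) (by simp) (by norm_num) hcl (by simp [List.getLast?_cons])
        (by simp)
    · exact largest_lt_len (z := 1) (by simp) (by norm_num) hcl (by simp [List.getLast?_cons])
        (by simp)
  · obtain ⟨Y, y, hy, hc, hh, e⟩ := h.image
    have h1 := dyckClass_injective hcl (by simp) hc hh e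
    rw [hX] at h1
    have h2 := congrArg List.reverse h1
    have hep : ep = 0 ∨ ep = 1 := by omega
    rcases hep with rfl | rfl
    · simp at h2
    · simp at h2
      omega

theorem Ptn.size_eq_sum (la : Ptn) : la.size = la.parts.sum := la.2.parts_sum.symm

theorem length_bWord (la : Ptn) : (bWord la).length = la.largest + la.len := by
  have : ∀ l : List ℤ, IsWord 0 l → l.length = l.count 0 + l.count 1 := by
    intro l
    induction l with
    | nil => simp
    | cons x l ih =>
      intro h
      rw [isWord_cons] at h
      rcases h.1 with rfl | rfl
      · simp [ih h.2]
        ring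
      · simp [ih h.2]
        ring
  rw [this _ (isWord_bWord la), count_zero_bWord, count_one_bWord]

theorem length_flagVec (la : Ptn) {a : ℕ} (ep : Fin 2) (ha : 2 ≤ a) :
    (flagVec la a ep).length = 3 + a + la.largest + la.len := by
  simp only [flagVec_eq, flagBody, List.length_cons, List.length_append, List.length_replicate,
    List.length_map, length_bWord]
  omega

theorem deficit_replicate_two (n : ℕ) : deficit (List.replicate n 2) = -2 * n := by
  induction n with
  | zero => rfl
  | succ n ih =>
    rw [List.replicate_succ, deficit, ih, cnt_two (fun x hx => by
      rw [List.eq_of_mem_replicate hx]; simp)]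
    simp [List.count_replicate]
    ring

theorem cross_replicate (n : ℕ) (x : ℤ) (l : List ℤ) :
    cross (List.replicate n x) l = n * cnt x l := by
  simp [cross]

theorem deficit_flagVec (la : Ptn) {a : ℕ} (ep : Fin 2) (ha : 2 ≤ a) :
    deficit (flagVec la a ep) = la.size + a + 1 + la.largest + la.len := by
  set W := (bWord la).map (fun x => x + 1) with hW
  have wW : IsWord 1 W := (isWord_bWord la).map_succ
  have tW := IsWord.ternary (Or.inr wW)
  have inj : Function.Injective (fun x : ℤ => x + 1) := add_left_injective 1
  have c0 : W.count 0 = 0 := wW.count_eq_zero (by norm_num) (by norm_num)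
  have c1 : W.count 1 = la.largest := by
    rw [← count_zero_bWord]
    exact List.count_map_of_injective _ _ inj 0
  have c2 : W.count 2 = la.len := by
    rw [← count_one_bWord]
    exact List.count_map_of_injective _ _ inj 1
  have dW : deficit W = la.size - la.len - (la.largest + la.len) := by
    rw [hW, deficit_map_succ, length_bWord, deficit_binary (isWord_bWord la), heights_bWord,
      count_one_bWord, Ptn.size_eq_sum]
    push_cast
    ring
  have tR : ∀ b, ∀ x ∈ List.replicate b (2 : ℤ), x = 0 ∨ x = 1 ∨ x = 2 := fun b x hx =>
    Or.inr (Or.inr (List.eq_of_mem_replicate hx))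
  rw [flagVec_eq, flagBody, ← hW]
  have hep : ep = 0 ∨ ep = 1 := by omega
  obtain ⟨a, rfl⟩ := Nat.exists_eq_add_of_le ha
  rcases hep with rfl | rfl
  · simp [deficit, deficit_append, cnt_cons, cnt_append, cnt_zero tW, cnt_one tW, cnt_two tW,
      cnt_zero (tR _), cnt_one (tR _), cross_replicate, List.count_replicate, c0, c1, c2, dW,
      deficit_replicate_two]
    ring
  · simp [deficit, deficit_append, cnt_cons, cnt_append, cnt_nil, cnt_zero tW, cnt_one tW,
      cnt_two tW,
      cnt_zero (tR _), cnt_one (tR _), cross_replicate, List.count_replicate, c0, c1, c2, dW,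
      deficit_replicate_two, cross_append_right, cross_one tW]
    ring

theorem exists_isTI2_flagVec (la : Ptn) {a : ℕ} (ep : Fin 2) (ha : 2 ≤ a) :
    ∃ mu : Ptn, IsTI2 mu (dyckClass (flagVec la a ep)) ∧
      mu.size = la.size + a + 1 + la.largest + la.len := by
  have hw := isWord_one_replicate_flag la (a - ep.val) ep.val
  have h := endsInTail hw (by simp [flagBody]) (by
    obtain ⟨X, hX⟩ := flagBody_last la (b := a - ep.val) (by omega)
    rw [hX]
    simp)
  rw [← flagVec_eq] at h
  obtain ⟨mu, h1, h2⟩ := h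
  refine ⟨mu, ⟨?_, not_ND_flagVec la ep ha⟩, ?_⟩
  · rw [flagVec_eq, cl_zero_cons, ← flagVec_eq] at h1
    exact Relation.reflTransGen_swap.mpr h1
  · rw [deficit_flagVec la ep ha] at h2
    exact_mod_cast h2

/-! ### Counting generalized flagpole partitions -/

/-- The finite set of partitions of size `n`. -/
def ptns (n : ℕ) : Finset Ptn := Finset.univ.map (Function.Embedding.sigmaMk n)

theorem mem_ptns {n : ℕ} {la : Ptn} : la ∈ ptns n ↔ la.size = n := by
  constructor
  · intro h
    obtain ⟨x, -, rfl⟩ := Finset.mem_map.mp h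
    rfl
  · rintro rfl
    exact Finset.mem_map.mpr ⟨la.2, Finset.mem_univ _, rfl⟩

theorem card_ptns (n : ℕ) : (ptns n).card = p n := by
  rw [ptns, Finset.card_map, p, Finset.card_univ]

theorem q_eq_card (i : ℤ) (j : ℕ) : q i j = ((ptns j).filter fun la => longestHook la = i).card := by
  rw [q, ← Set.ncard_coe_finset]
  congr 1
  ext la
  simp [mem_ptns]

theorem add_pred_le_sum {s : Multiset ℕ} (h : ∀ x ∈ s, 0 < x) {y : ℕ} (hy : y ∈ s) :
    y + s.card ≤ s.sum + 1 := by
  obtain ⟨t, rfl⟩ := Multiset.exists_cons_of_mem hy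
  have : t.card ≤ t.sum := by
    have := Multiset.card_nsmul_le_sum (s := t) (a := 1)
      fun x hx => h x (Multiset.mem_cons_of_mem hx)
    simpa using this
  simp
  omega

theorem longestHook_le (la : Ptn) (h : la.size ≠ 0) : longestHook la ≤ la.size := by
  have h0 : la.largest ≠ 0 := by
    intro h0
    apply h
    rw [Ptn.size_eq_sum, Multiset.sum_eq_zero_iff]
    intro x hx
    have := Ptn.le_largest hx
    omega
  have := add_pred_le_sum (fun x hx => Ptn.parts_pos hx) (Ptn.exists_largest_mem h0)
  rw [← Ptn.size_eq_sum] at this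
  rw [longestHook, Ptn.len]
  omega

theorem sum_q (j : ℕ) (hj : j ≠ 0) (m : ℤ) :
    ∑ i ∈ Finset.Icc m j, (q i j : ℤ) =
      ((ptns j).filter fun la => m ≤ longestHook la).card := by
  rw [Finset.card_eq_sum_card_fiberwise (f := longestHook) (t := Finset.Icc m j)]
  · push_cast
    refine Finset.sum_congr rfl fun i hi => ?_
    rw [q_eq_card, Finset.filter_filter]
    congr 2
    ext la
    simp only [Finset.mem_filter, and_congr_right_iff]
    intro _
    constructor
    · rintro rfl
      exact ⟨(Finset.mem_Icc.mp hi).1, rfl⟩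
    · exact fun h => h.2
  · intro la hla
    rw [Finset.mem_coe, Finset.mem_filter, mem_ptns] at hla
    rw [Finset.mem_coe, Finset.mem_Icc]
    refine ⟨hla.2, ?_⟩
    have := longestHook_le la (by omega)
    omega

theorem sum_card_le_g (star : Ptn → Ptn) (k : ℕ) :
    ∑ j ∈ Finset.Ico 1 k, 2 * ((ptns j).filter fun la =>
      longestHook la < (k : ℤ) - 3 - j ∧ longestHook (star la) < (k : ℤ) - 3 - j).card ≤
        g star k := by
  classical
  choose f hf1 hf2 using fun (la : Ptn) (n : ℕ) (ep : Fin 2) =>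
    exists_isTI2_flagVec la (a := n + 2) ep (by omega)
  set S : ℕ → Finset Ptn := fun j => (ptns j).filter fun la =>
      longestHook la < (k : ℤ) - 3 - j ∧ longestHook (star la) < (k : ℤ) - 3 - j with hS
  have hmem : ∀ j la, la ∈ S j ↔ la.size = j ∧ ((la.largest : ℤ) + la.len - 1 < k - 3 - j ∧
      ((star la).largest : ℤ) + (star la).len - 1 < k - 3 - j) := by
    intro j la
    rw [hS, Finset.mem_filter, mem_ptns]
    rfl
  have hg : g star k = ((ptns k).filter (IsGenFlagpole star)).card := by
    rw [g, ← Set.ncard_coe_finset]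
    congr 1
    ext la
    simp [mem_ptns]
  have hcard : ∑ j ∈ Finset.Ico 1 k, 2 * (S j).card =
      ((Finset.Ico 1 k).sigma fun j => S j ×ˢ (Finset.univ : Finset (Fin 2))).card := by
    rw [Finset.card_sigma]
    refine Finset.sum_congr rfl fun j _ => ?_
    rw [Finset.card_product, Finset.card_univ, Fintype.card_fin, mul_comm]
  rw [hcard, hg]
  -- The argument solves |λ| + a + 1 + λ₁ + ℓ(λ) = k with a = n + 2. The hook bound on λ makes the
  -- natural subtraction exact.
  refine Finset.card_le_card_of_injOn
    (fun x => f x.2.1 (k - 3 - x.1 - x.2.1.largest - x.2.1.len) x.2.2) ?_ ?_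
  · rintro ⟨j, la, ep⟩ h
    rw [Finset.mem_coe] at h
    simp only [Finset.mem_sigma, Finset.mem_product, hmem] at h
    rw [Finset.mem_coe, Finset.mem_filter, mem_ptns]
    obtain ⟨-, ⟨hj, h1, h2⟩, -⟩ := h
    dsimp only
    refine ⟨?_, la, _, ep, Nat.le_add_left _ _, hf1 _ _ _, ?_, ?_⟩
    · rw [hf2, hj]
      omega
    · rw [length_flagVec _ _ (Nat.le_add_left _ _)]
      omega
    · rw [length_flagVec _ _ (Nat.le_add_left _ _)]
      omega
  · rintro ⟨j, la, ep⟩ h ⟨j', la', ep'⟩ h' e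
    rw [Finset.mem_coe] at h h'
    simp only [Finset.mem_sigma, Finset.mem_product, hmem] at h h'
    dsimp only at e
    have h1 := hf1 la (k - 3 - j - la.largest - la.len) ep
    rw [e] at h1
    obtain ⟨rfl, -, rfl⟩ := dyckClass_flagVec_injective (Nat.le_add_left _ _)
      (Nat.le_add_left _ _) (h1.unique (hf1 _ _ _))
    obtain rfl : j = j' := h.2.1.1.symm.trans h'.2.1.1
    rfl

section Star

variable {star : Ptn → Ptn} (hinv : Function.Involutive star)
  (hsize : ∀ la : Ptn, (star la).size = la.size)
include hinv hsize

theorem card_filter_star (j : ℕ) (m : ℤ) :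
    ((ptns j).filter fun la => m ≤ longestHook (star la)).card =
      ((ptns j).filter fun la => m ≤ longestHook la).card := by
  refine Finset.card_bij' (fun la _ => star la) (fun la _ => star la) ?_ ?_ ?_ ?_
  · intro la h
    simp only [Finset.mem_filter, mem_ptns] at h ⊢
    rwa [hsize]
  · intro la h
    simp only [Finset.mem_filter, mem_ptns] at h ⊢
    rwa [hsize, hinv la]
  · exact fun la _ => hinv la
  · exact fun la _ => hinv la

/-- Union bound; the two exceptional sets are equinumerous because the involution preserves size. -/
theorem card_short_hooks (j : ℕ) (m : ℤ) :
    (p j : ℤ) - 2 * ((ptns j).filter fun la => m ≤ longestHook la).card ≤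
      ((ptns j).filter fun la => longestHook la < m ∧ longestHook (star la) < m).card := by
  have h : ptns j ⊆ ((ptns j).filter fun la => longestHook la < m ∧ longestHook (star la) < m) ∪
      (((ptns j).filter fun la => m ≤ longestHook la) ∪
        ((ptns j).filter fun la => m ≤ longestHook (star la))) := by
    intro la hla
    simp only [Finset.mem_union, Finset.mem_filter, hla, true_and]
    omega
  have h1 := (Finset.card_le_card h).trans ((Finset.card_union_le _ _).trans
    (Nat.add_le_add_left (Finset.card_union_le _ _) _))
  rw [card_filter_star hinv hsize, card_ptns] at h1
  omega

theorem sum_le_g (k : ℕ) :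
    ∑ j ∈ Finset.Ico 1 k,
        2 * max 0 ((p j : ℤ) - 2 * ∑ i ∈ Finset.Icc ((k : ℤ) - 3 - j) j, (q i j : ℤ))
      ≤ (g star k : ℤ) := by
  refine le_trans ?_ (Int.ofNat_le.mpr (sum_card_le_g star k))
  push_cast
  refine Finset.sum_le_sum fun j hj => ?_
  rw [sum_q j (by have := (Finset.mem_Ico.mp hj).1; omega)]
  have := card_short_hooks hinv hsize j ((k : ℤ) - 3 - j)
  omega

end Star

/-! ### Elementary bounds for the number of partitions -/

theorem Ptn.parts_ofMultiset_of_pos {s : Multiset ℕ} (h : ∀ x ∈ s, x ≠ 0) :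
    (Ptn.ofMultiset s).parts = s := by
  rw [Ptn.parts_ofMultiset, Multiset.filter_eq_self]
  exact h

theorem Ptn.size_ofMultiset (s : Multiset ℕ) : (Ptn.ofMultiset s).size = s.sum := rfl

theorem Ptn.parts_ne_zero {la : Ptn} : ∀ x ∈ la.parts, x ≠ 0 := fun _ hx =>
  (Ptn.parts_pos hx).ne'

theorem card_filter_mem {d n : ℕ} (hd : 0 < d) (hn : d ≤ n) :
    ((ptns n).filter fun la => d ∈ la.parts).card = p (n - d) := by
  rw [← card_ptns]
  symm
  have hc : ∀ la : Ptn, (Ptn.ofMultiset (d ::ₘ la.parts)).parts = d ::ₘ la.parts := fun la =>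
    Ptn.parts_ofMultiset_of_pos (by simpa using ⟨hd.ne', Ptn.parts_ne_zero⟩)
  refine Finset.card_bij (fun la _ => Ptn.ofMultiset (d ::ₘ la.parts)) ?_ ?_ ?_
  · intro la h
    rw [mem_ptns] at h
    rw [Finset.mem_filter, mem_ptns, hc, Ptn.size_ofMultiset, Multiset.sum_cons,
      ← Ptn.size_eq_sum]
    exact ⟨by omega, Multiset.mem_cons_self _ _⟩
  · intro la _ mu _ h
    have := congrArg Ptn.parts h
    rw [hc, hc, Multiset.cons_inj_right] at this
    exact Ptn.ext_parts this
  · intro mu h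
    rw [Finset.mem_filter, mem_ptns] at h
    obtain ⟨t, ht⟩ := Multiset.exists_cons_of_mem h.2
    have htp : ∀ x ∈ t, x ≠ 0 := fun x hx =>
      Ptn.parts_ne_zero x (by rw [ht]; exact Multiset.mem_cons_of_mem hx)
    refine ⟨Ptn.ofMultiset t, ?_, ?_⟩
    · have := h.1
      rw [Ptn.size_eq_sum, ht, Multiset.sum_cons] at this
      rw [mem_ptns, Ptn.size_ofMultiset]
      omega
    · apply Ptn.ext_parts
      rw [hc, Ptn.parts_ofMultiset_of_pos htp, ht]

theorem p_mono : Monotone p := by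
  apply monotone_nat_of_le_succ
  intro n
  have h := card_filter_mem (d := 1) (n := n + 1) one_pos (by omega)
  rw [Nat.add_sub_cancel] at h
  rw [← h, ← card_ptns]
  exact Finset.card_filter_le _ _

theorem p_pos (n : ℕ) : 0 < p n := Fintype.card_pos

/-- Double counting of pairs (λ, d) with d a part of λ, weighted by d: the distinct parts of λ sum
to at most n. -/
theorem sum_mul_p_le (n s : ℕ) (hs : s ≤ n) :
    ∑ d ∈ Finset.Icc 1 s, d * p (n - d) ≤ n * p n := by
  calc ∑ d ∈ Finset.Icc 1 s, d * p (n - d)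
      = ∑ d ∈ Finset.Icc 1 s, ∑ la ∈ ptns n, if d ∈ la.parts then d else 0 := by
        refine Finset.sum_congr rfl fun d hd => ?_
        rw [Finset.mem_Icc] at hd
        rw [← Finset.sum_filter, Finset.sum_const, card_filter_mem (by omega) (by omega),
          smul_eq_mul, mul_comm]
    _ = ∑ la ∈ ptns n, ∑ d ∈ Finset.Icc 1 s, if d ∈ la.parts then d else 0 := Finset.sum_comm
    _ ≤ ∑ la ∈ ptns n, n := by
        refine Finset.sum_le_sum fun la hla => ?_
        rw [mem_ptns, Ptn.size_eq_sum] at hla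
        rw [← Finset.sum_filter, ← hla]
        have h : (Finset.filter (fun d => d ∈ la.parts) (Finset.Icc 1 s)).val ≤ la.parts := by
          rw [Multiset.le_iff_subset (Finset.nodup _)]
          intro x hx
          exact (Finset.mem_filter.mp (Finset.mem_val.mp hx)).2
        obtain ⟨u, hu⟩ := Multiset.le_iff_exists_add.mp h
        have := congrArg Multiset.sum hu
        rw [Multiset.sum_add] at this
        rw [this, Finset.sum, Multiset.map_id']
        exact Nat.le_add_right _ _
    _ = n * p n := by rw [Finset.sum_const, card_ptns, smul_eq_mul, mul_comm]

/-- Replacing each p(n - d) by the smaller p(n - s) leaves 1 + ⋯ + s ≥ s²/2 as a factor. -/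
theorem sq_mul_p_le (n s : ℕ) (hs : s ≤ n) : s ^ 2 * p (n - s) ≤ 2 * n * p n := by
  have h1 : (∑ d ∈ Finset.Icc 1 s, d) * p (n - s) ≤ n * p n := by
    rw [Finset.sum_mul]
    refine le_trans (Finset.sum_le_sum fun d hd => ?_) (sum_mul_p_le n s hs)
    have := (Finset.mem_Icc.mp hd).2
    exact Nat.mul_le_mul_left _ (p_mono (by omega))
  have h2 : s ^ 2 ≤ 2 * ∑ d ∈ Finset.Icc 1 s, d := by
    clear hs h1
    induction s with
    | zero => simp
    | succ s ih =>
      rw [Finset.sum_Icc_succ_top (by omega)]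
      nlinarith
  nlinarith [Nat.mul_le_mul_right (p (n - s)) h2]

/-! ### Partitions with a long hook -/

theorem card_largest_ge {n m : ℕ} (hm : 0 < m) (hn : m ≤ n) :
    ((ptns n).filter fun la => m ≤ la.largest).card ≤ n * p (n - m) := by
  have h : ((ptns n).filter fun la => m ≤ la.largest) ⊆
      (Finset.Icc m n).biUnion fun d => (ptns n).filter fun la => d ∈ la.parts := by
    intro la hla
    rw [Finset.mem_filter] at hla
    have h1 := Ptn.exists_largest_mem (la := la) (by omega)
    have h2 := Multiset.le_sum_of_mem h1
    rw [← Ptn.size_eq_sum, mem_ptns.mp hla.1] at h2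
    exact Finset.mem_biUnion.mpr ⟨la.largest, Finset.mem_Icc.mpr ⟨hla.2, h2⟩,
      Finset.mem_filter.mpr ⟨hla.1, h1⟩⟩
  refine (Finset.card_le_card h).trans ((Finset.card_biUnion_le_card_mul _ _ (p (n - m)) ?_).trans ?_)
  · intro d hd
    rw [Finset.mem_Icc] at hd
    rw [card_filter_mem (by omega) hd.2]
    exact p_mono (by omega)
  · refine Nat.mul_le_mul_right _ ?_
    rw [Nat.card_Icc]
    omega

theorem Ptn.len_le_size (la : Ptn) : la.len ≤ la.size := by
  rw [Ptn.size_eq_sum, Ptn.len]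
  have := Multiset.card_nsmul_le_sum (s := la.parts) (a := 1) fun x hx => Ptn.parts_pos hx
  simpa using this

theorem sum_map_pred (la : Ptn) :
    (la.parts.map fun x => x - 1).sum + la.len = la.size := by
  rw [Ptn.size_eq_sum, Ptn.len]
  have h : ∀ s : Multiset ℕ, (∀ x ∈ s, x ≠ 0) → (s.map fun x => x - 1).sum + s.card = s.sum := by
    intro s
    induction s using Multiset.induction_on with
    | empty => simp
    | cons a s ih =>
      intro h
      have h1 := ih fun x hx => h x (Multiset.mem_cons_of_mem hx)
      have h2 := h a (Multiset.mem_cons_self _ _)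
      simp only [Multiset.map_cons, Multiset.sum_cons, Multiset.card_cons]
      omega
  exact h _ Ptn.parts_ne_zero

theorem card_len_eq_le (n m : ℕ) :
    ((ptns n).filter fun la => la.len = m).card ≤ p (n - m) := by
  rw [← card_ptns]
  refine Finset.card_le_card_of_injOn
    (fun la => Ptn.ofMultiset (la.parts.map fun x => x - 1)) ?_ ?_
  · intro la h
    rw [Finset.mem_coe, Finset.mem_filter, mem_ptns] at h
    rw [Finset.mem_coe, mem_ptns, Ptn.size_ofMultiset]
    have := sum_map_pred la
    omega
  · intro la h mu h' e
    rw [Finset.mem_coe, Finset.mem_filter] at h h'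
    have e' := congrArg Ptn.parts e
    rw [Ptn.parts_ofMultiset, Ptn.parts_ofMultiset] at e'
    exact Ptn.eq_of_filter_map_pred (h.2.trans h'.2.symm) e'

theorem card_len_ge {n m : ℕ} (hm : 0 < m) :
    ((ptns n).filter fun la => m ≤ la.len).card ≤ n * p (n - m) := by
  have h : ((ptns n).filter fun la => m ≤ la.len) ⊆
      (Finset.Icc m n).biUnion fun d => (ptns n).filter fun la => la.len = d := by
    intro la hla
    rw [Finset.mem_filter] at hla
    have h2 := Ptn.len_le_size la
    rw [mem_ptns.mp hla.1] at h2
    exact Finset.mem_biUnion.mpr ⟨la.len, Finset.mem_Icc.mpr ⟨hla.2, h2⟩,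
      Finset.mem_filter.mpr ⟨hla.1, rfl⟩⟩
  refine (Finset.card_le_card h).trans ((Finset.card_biUnion_le_card_mul _ _ (p (n - m)) ?_).trans ?_)
  · intro d hd
    rw [Finset.mem_Icc] at hd
    exact (card_len_eq_le n d).trans (p_mono (by omega))
  · refine Nat.mul_le_mul_right _ ?_
    rw [Nat.card_Icc]
    omega

/-- Since λ₁ + ℓ ≥ h + 1 ≥ 2m - 1, one of λ₁ and ℓ is at least m. -/
theorem card_longestHook_ge {n m : ℕ} {h : ℤ} (hm : 0 < m) (hn : m ≤ n)
    (hh : 2 * (m : ℤ) ≤ h + 2) :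
    ((ptns n).filter fun la => h ≤ longestHook la).card ≤ 2 * n * p (n - m) := by
  have hs : ((ptns n).filter fun la => h ≤ longestHook la) ⊆
      ((ptns n).filter fun la => m ≤ la.largest) ∪ ((ptns n).filter fun la => m ≤ la.len) := by
    intro la hla
    rw [Finset.mem_filter, longestHook] at hla
    rw [Finset.mem_union, Finset.mem_filter, Finset.mem_filter]
    by_cases h1 : m ≤ la.largest
    · exact Or.inl ⟨hla.1, h1⟩
    · exact Or.inr ⟨hla.1, by omega⟩
  have := (Finset.card_le_card hs).trans (Finset.card_union_le _ _)
  have := card_largest_ge hm hn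
  have := card_len_ge (n := n) hm
  nlinarith

/-! ### Comparing p at sums and multiples -/

/-- Parts are put into S while they fit under a. The first that does not fit is set aside, and the
remainder T then has sum below b. The part set aside is determined by the sums; it is 0 if none is
needed. -/
theorem exists_split (s : Multiset ℕ) : ∀ a b : ℕ, s.sum = a + b → (∀ x ∈ s, x ≠ 0) →
    ∃ S T : Multiset ℕ, (∀ x ∈ S, x ≠ 0) ∧ (∀ x ∈ T, x ≠ 0) ∧ S.sum ≤ a ∧ T.sum ≤ b ∧
      s = ((a + b - S.sum - T.sum) ::ₘ (S + T)).filter (· ≠ 0) := by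
  induction s using Multiset.induction_on with
  | empty =>
    intro a b h _
    refine ⟨0, 0, by simp, by simp, by simp, by simp, ?_⟩
    rw [← h]
    simp
  | cons x s ih =>
    intro a b h hp
    have hx := hp x (Multiset.mem_cons_self _ _)
    have hs : ∀ y ∈ s, y ≠ 0 := fun y hy => hp y (Multiset.mem_cons_of_mem hy)
    rw [Multiset.sum_cons] at h
    by_cases hxa : x ≤ a
    · obtain ⟨S, T, h1, h2, h3, h4, h5⟩ := ih (a - x) b (by omega) hs
      refine ⟨x ::ₘ S, T, by simpa using ⟨hx, h1⟩, h2, by simp; omega, h4, ?_⟩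
      rw [Multiset.cons_add, Multiset.cons_swap, Multiset.filter_cons_of_pos (p := (· ≠ 0)) _ hx,
        Multiset.sum_cons, show a + b - (x + S.sum) - T.sum = a - x + b - S.sum - T.sum by omega,
        ← h5]
    · refine ⟨0, s, by simp, hs, by simp, by omega, ?_⟩
      rw [Multiset.sum_zero, zero_add, show a + b - 0 - s.sum = x by omega,
        Multiset.filter_cons_of_pos (p := (· ≠ 0)) _ hx, Multiset.filter_eq_self.mpr hs]

theorem p_add_le (a b : ℕ) : p (a + b) ≤ (a + b + 1) ^ 2 * (p a * p b) := by
  classical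
  set U : ℕ → Finset Ptn := fun n => (Finset.range (n + 1)).biUnion ptns with hU
  have hmem : ∀ n la, la ∈ U n ↔ la.size ≤ n := by
    intro n la
    simp [hU, mem_ptns]
  have hc : ∀ n, (U n).card ≤ (n + 1) * p n := by
    intro n
    refine (Finset.card_biUnion_le_card_mul _ _ (p n) fun m hm => ?_).trans (by simp)
    rw [card_ptns]
    exact p_mono (by simpa [Nat.lt_succ_iff] using hm)
  have hsub : ptns (a + b) ⊆ (U a ×ˢ U b).image fun x =>
      Ptn.ofMultiset ((a + b - x.1.size - x.2.size) ::ₘ (x.1.parts + x.2.parts)) := by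
    intro la hla
    rw [mem_ptns, Ptn.size_eq_sum] at hla
    obtain ⟨S, T, h1, h2, h3, h4, h5⟩ := exists_split la.parts a b hla Ptn.parts_ne_zero
    refine Finset.mem_image.mpr ⟨(Ptn.ofMultiset S, Ptn.ofMultiset T), ?_, ?_⟩
    · rw [Finset.mem_product, hmem, hmem]
      exact ⟨h3, h4⟩
    · apply Ptn.ext_parts
      rw [Ptn.parts_ofMultiset, Ptn.parts_ofMultiset_of_pos h1, Ptn.parts_ofMultiset_of_pos h2]
      exact h5.symm
  have h1 := (Finset.card_le_card hsub).trans Finset.card_image_le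
  rw [card_ptns, Finset.card_product] at h1
  calc p (a + b) ≤ (U a).card * (U b).card := h1
    _ ≤ ((a + 1) * p a) * ((b + 1) * p b) := Nat.mul_le_mul (hc a) (hc b)
    _ = ((a + 1) * (b + 1)) * (p a * p b) := by ring
    _ ≤ _ := Nat.mul_le_mul_right _ (by nlinarith)

theorem sum_map_two_mul (s : Multiset ℕ) : (s.map (2 * ·)).sum = 2 * s.sum := by
  rw [Multiset.sum_map_mul_left, Multiset.map_id']

/-- Encode λ by even parts 2x and μ by odd parts 2y + 1 ≥ 3. Padding with a - ℓ(μ) ones gives total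
size 2a + 2a + a. -/
theorem sq_p_le (a : ℕ) : p a ^ 2 ≤ p (5 * a) := by
  rw [sq, ← card_ptns a, ← Finset.card_product, ← card_ptns]
  have hparts : ∀ (la mu : Ptn) (n : ℕ),
      (Ptn.ofMultiset (la.parts.map (2 * ·) + mu.parts.map (2 * · + 1) +
        Multiset.replicate n 1)).parts =
      la.parts.map (2 * ·) + mu.parts.map (2 * · + 1) + Multiset.replicate n 1 := by
    intro la mu n
    apply Ptn.parts_ofMultiset_of_pos
    intro x hx
    simp only [Multiset.mem_add, Multiset.mem_map, Multiset.mem_replicate] at hx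
    rcases hx with (⟨y, hy, rfl⟩ | ⟨y, hy, rfl⟩) | ⟨-, rfl⟩
    · have := Ptn.parts_pos hy
      omega
    · omega
    · omega
  refine Finset.card_le_card_of_injOn
    (fun x => Ptn.ofMultiset (x.1.parts.map (2 * ·) + x.2.parts.map (2 * · + 1) +
        Multiset.replicate (a - x.2.len) 1)) ?_ ?_
  · rintro ⟨la, mu⟩ h
    rw [Finset.mem_coe, Finset.mem_product, mem_ptns, mem_ptns] at h
    rw [Finset.mem_coe, mem_ptns, Ptn.size_ofMultiset]
    obtain ⟨ha, hb⟩ := h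
    dsimp only at ha hb ⊢
    have h1 := Ptn.len_le_size mu
    have h2 : mu.parts.card = mu.len := rfl
    have h3 := la.size_eq_sum
    have h4 := mu.size_eq_sum
    have h5 := sum_map_two_mul la.parts
    have h6 : (mu.parts.map (HMul.hMul 2)).sum = 2 * mu.parts.sum := sum_map_two_mul mu.parts
    simp only [Multiset.sum_add, Multiset.sum_map_add, Multiset.map_const',
      Multiset.sum_replicate, smul_eq_mul]
    omega
  · rintro ⟨la, mu⟩ - ⟨la', mu'⟩ - e
    have e1 := congrArg Ptn.parts e
    dsimp only at e1
    rw [hparts, hparts] at e1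
    have ev : ∀ (la mu : Ptn) (n : ℕ), (la.parts.map (2 * ·) + mu.parts.map (2 * · + 1) +
        Multiset.replicate n 1).filter (fun x => x % 2 = 0) = la.parts.map (2 * ·) := by
      intro la mu n
      rw [Multiset.filter_add, Multiset.filter_add, Multiset.filter_eq_self.mpr,
        Multiset.filter_eq_nil.mpr, Multiset.filter_eq_nil.mpr, add_zero, add_zero]
      · intro x hx
        simp [Multiset.eq_of_mem_replicate hx]
      · intro x hx
        obtain ⟨y, -, rfl⟩ := Multiset.mem_map.mp hx
        omega
      · intro x hx
        obtain ⟨y, -, rfl⟩ := Multiset.mem_map.mp hx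
        omega
    have od : ∀ (la mu : Ptn) (n : ℕ), (la.parts.map (2 * ·) + mu.parts.map (2 * · + 1) +
        Multiset.replicate n 1).filter (fun x => x % 2 = 1 ∧ x ≠ 1) =
        mu.parts.map (2 * · + 1) := by
      intro la mu n
      rw [Multiset.filter_add, Multiset.filter_add, Multiset.filter_eq_nil.mpr,
        Multiset.filter_eq_self.mpr, Multiset.filter_eq_nil.mpr, add_zero, zero_add]
      · intro x hx
        simp [Multiset.eq_of_mem_replicate hx]
      · intro x hx
        obtain ⟨y, hy, rfl⟩ := Multiset.mem_map.mp hx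
        have := Ptn.parts_pos hy
        omega
      · intro x hx
        obtain ⟨y, -, rfl⟩ := Multiset.mem_map.mp hx
        omega
    have e2 := congrArg (Multiset.filter fun x => x % 2 = 0) e1
    have e3 := congrArg (Multiset.filter fun x => x % 2 = 1 ∧ x ≠ 1) e1
    rw [ev, ev] at e2
    rw [od, od] at e3
    have i1 : Function.Injective (2 * · : ℕ → ℕ) := fun x y h => by
      dsimp only at h
      omega
    have i2 : Function.Injective (2 * · + 1 : ℕ → ℕ) := fun x y h => by
      dsimp only at h
      omega
    rw [Prod.mk.injEq]
    exact ⟨Ptn.ext_parts (Multiset.map_injective i1 e2),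
      Ptn.ext_parts (Multiset.map_injective i2 e3)⟩

theorem p_pow_le (a N : ℕ) : p a ^ 2 ^ N ≤ p (5 ^ N * a) := by
  induction N with
  | zero => simp
  | succ N ih =>
    calc p a ^ 2 ^ (N + 1) = (p a ^ 2 ^ N) ^ 2 := by rw [pow_succ, pow_mul]
      _ ≤ p (5 ^ N * a) ^ 2 := Nat.pow_le_pow_left ih 2
      _ ≤ p (5 * (5 ^ N * a)) := sq_p_le _
      _ = p (5 ^ (N + 1) * a) := by rw [pow_succ]; congr 1; ring

/-! ### Asymptotics -/

open Filter in
theorem eventually_pow_le_p (A : ℕ) : ∀ᶠ k : ℕ in atTop, (k + 1) ^ A ≤ p k := by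
  set N := 2 * A with hN
  set C := 2 * 5 ^ N with hC
  have hC0 : 0 < C := by positivity
  filter_upwards [eventually_ge_atTop (32 * C * C)] with k hk
  set n := k / C with hn
  have hn1 : 32 * C ≤ n := (Nat.le_div_iff_mul_le hC0).mpr hk
  have hk1 : k < C * (n + 1) := by
    have := Nat.lt_div_mul_add hC0 (a := k)
    rw [← hn] at this
    linarith
  -- A linear lower bound for p is enough, since `p_pow_le` raises it to any fixed power at the cost
  -- of a constant factor in the argument.
  have h0 : n / 4 ≤ p (2 * n) := by
    have h1 := sq_mul_p_le (2 * n) n (by omega)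
    have h2 := p_pos (2 * n - n)
    have h3 : n * n ≤ n * (4 * p (2 * n)) := by nlinarith
    have h4 := Nat.le_of_mul_le_mul_left h3 (by omega)
    omega
  have h1 : k + 1 ≤ (n / 4) ^ 2 := by
    have h2 : n ≤ 4 * (n / 4) + 3 := by omega
    have h3 : 8 * C ≤ n / 4 := by omega
    nlinarith
  calc (k + 1) ^ A ≤ ((n / 4) ^ 2) ^ A := Nat.pow_le_pow_left h1 A
    _ = (n / 4) ^ N := by rw [← pow_mul]
    _ ≤ p (2 * n) ^ N := Nat.pow_le_pow_left h0 N
    _ ≤ p (2 * n) ^ 2 ^ N := Nat.pow_le_pow_right (p_pos _) N.lt_two_pow_self.le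
    _ ≤ p (5 ^ N * (2 * n)) := p_pow_le _ _
    _ ≤ p k := p_mono (by
      have := Nat.mul_div_le k C
      calc 5 ^ N * (2 * n) = C * n := by rw [hC]; ring
        _ ≤ k := this)

/-- Two applications of `sq_mul_p_le` with s = ⌊m/2⌋ give s⁴ p(n - m) ≤ 4n² p(n). -/
theorem mul_p_sub_le {n m : ℕ} (hm : m ≤ n) (h : 32 * n ^ 3 ≤ (m / 2) ^ 4) :
    8 * n * p (n - m) ≤ p n := by
  rcases Nat.eq_zero_or_pos n with rfl | hn
  · simp
  set s := m / 2 with hs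
  have h1 := sq_mul_p_le n s (by omega)
  have h2 := sq_mul_p_le (n - s) s (by omega)
  have h3 : p (n - m) ≤ p (n - s - s) := p_mono (by omega)
  have h4 : s ^ 4 * p (n - m) ≤ (2 * n) ^ 2 * p n := by
    calc s ^ 4 * p (n - m) ≤ s ^ 4 * p (n - s - s) := Nat.mul_le_mul_left _ h3
      _ = s ^ 2 * (s ^ 2 * p (n - s - s)) := by ring
      _ ≤ s ^ 2 * (2 * (n - s) * p (n - s)) := Nat.mul_le_mul_left _ h2
      _ ≤ s ^ 2 * (2 * n * p (n - s)) :=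
        Nat.mul_le_mul_left _ (Nat.mul_le_mul_right _ (by omega))
      _ = 2 * n * (s ^ 2 * p (n - s)) := by ring
      _ ≤ 2 * n * (2 * n * p n) := Nat.mul_le_mul_left _ h1
      _ = _ := by ring
  have h5 : (2 * n) ^ 2 * (8 * n * p (n - m)) ≤ (2 * n) ^ 2 * p n := by
    refine le_trans ?_ h4
    calc (2 * n) ^ 2 * (8 * n * p (n - m)) = 32 * n ^ 3 * p (n - m) := by ring
      _ ≤ _ := Nat.mul_le_mul_right _ h
  exact Nat.le_of_mul_le_mul_left h5 (by positivity)

open Filter in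
theorem eventually_p_le_g {star : Ptn → Ptn} (hinv : Function.Involutive star)
    (hsize : ∀ la : Ptn, (star la).size = la.size) (M : ℕ) (hM : 0 < M) :
    ∀ᶠ k : ℕ in atTop, p (k - k / (M + 1)) ≤ g star k := by
  filter_upwards [eventually_ge_atTop (32 * 16 ^ 4 * (M + 1) ^ 5)] with k hk
  set r := k / (M + 1) with hr
  have hr1 : 32 * 16 ^ 4 * (M + 1) ^ 4 ≤ r := (Nat.le_div_iff_mul_le (by omega)).mpr (by
    calc _ = 32 * 16 ^ 4 * (M + 1) ^ 5 := by ring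
      _ ≤ k := hk)
  have hr2 : k < (M + 1) * (r + 1) := by
    have := Nat.lt_div_mul_add (a := k) (b := M + 1) (by omega)
    rw [← hr] at this
    linarith
  have hr3 : (M + 1) * r ≤ k := Nat.mul_div_le k (M + 1)
  have hM1 : 1 ≤ (M + 1) ^ 4 := Nat.one_le_pow _ _ (by omega)
  have hr4 : 1000 ≤ r := by omega
  have hMr : r ≤ M * r := Nat.le_mul_of_pos_left r hM
  have hr5 : 2 * r ≤ k := by linarith
  set j := k - r with hj
  -- The hook threshold is k - 3 - j = r - 3, and 2m ≤ r - 1 is what `card_longestHook_ge` requires.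
  set m := (r - 1) / 2 with hm
  have hpow : 32 * j ^ 3 ≤ (m / 2) ^ 4 := by
    have h1 : r ≤ 8 * (m / 2) := by omega
    have h2 : j ≤ 2 * (M + 1) * r := by
      have : (M + 1) * (r + 1) ≤ 2 * (M + 1) * r := by nlinarith
      omega
    have h3 : 8 ^ 4 * (32 * j ^ 3) ≤ 8 ^ 4 * (m / 2) ^ 4 := by
      calc 8 ^ 4 * (32 * j ^ 3) ≤ 8 ^ 4 * (32 * (2 * (M + 1) * r) ^ 3) := by gcongr
        _ = (32 * 16 ^ 3 * 8 * (M + 1) ^ 3) * r ^ 3 := by ring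
        _ ≤ (32 * 16 ^ 4 * (M + 1) ^ 4) * r ^ 3 := by
          apply Nat.mul_le_mul_right
          have : (M + 1) ^ 3 ≤ (M + 1) ^ 4 := Nat.pow_le_pow_right (by omega) (by omega)
          omega
        _ ≤ r * r ^ 3 := Nat.mul_le_mul_right _ hr1
        _ = r ^ 4 := by ring
        _ ≤ (8 * (m / 2)) ^ 4 := Nat.pow_le_pow_left h1 4
        _ = _ := by ring
    exact Nat.le_of_mul_le_mul_left h3 (by norm_num)
  have hp := mul_p_sub_le (n := j) (m := m) (by omega) hpow
  have hb := card_longestHook_ge (n := j) (m := m) (h := (k : ℤ) - 3 - j) (by omega) (by omega)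
    (by omega)
  have hs := card_short_hooks hinv hsize j ((k : ℤ) - 3 - j)
  have hg := sum_card_le_g star k
  have hg1 := (Finset.single_le_sum (f := fun j : ℕ => 2 * ((ptns j).filter fun la =>
      longestHook la < (k : ℤ) - 3 - j ∧ longestHook (star la) < (k : ℤ) - 3 - j).card)
      (fun _ _ => Nat.zero_le _) (Finset.mem_Ico.mpr ⟨by omega, by omega⟩ :
        j ∈ Finset.Ico 1 k)).trans hg
  -- At most a quarter of the partitions of j have a long hook, so at least half survive the union
  -- bound; the factor 2 from ε restores p(j).
  have hb' : 4 * ((ptns j).filter fun la => (k : ℤ) - 3 - j ≤ longestHook la).card ≤ p j := by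
    nlinarith
  omega

open Filter in
theorem eventually_rpow_lt_g {star : Ptn → Ptn} (hinv : Function.Involutive star)
    (hsize : ∀ la : Ptn, (star la).size = la.size) {c : ℝ} (hc : c < 1) :
    ∀ᶠ k : ℕ in atTop, (p k : ℝ) ^ c < (g star k : ℝ) := by
  -- The margin 1 - c is split in two: A makes the loss (k + 1)² at most p(k) to the power (1 -
  -- c)/2, and N makes p(r) ≤ p(j)^(1/2^N) small enough for the other half.
  obtain ⟨A, hA⟩ := exists_nat_gt (4 / (1 - c))
  obtain ⟨N, hN⟩ := pow_unbounded_of_one_lt (2 * c / (1 - c)) (one_lt_two (α := ℝ))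
  have h1c : 0 < 1 - c := by linarith
  rw [div_lt_iff₀ h1c] at hA hN
  filter_upwards [eventually_p_le_g hinv hsize (5 ^ N) (by positivity), eventually_pow_le_p A,
    eventually_ge_atTop 1] with k h1 h2 h3
  set r := k / (5 ^ N + 1) with hr
  have hr3 : (5 ^ N + 1) * r ≤ k := Nat.mul_div_le k (5 ^ N + 1)
  set j := k - r with hj
  have hjr : j + r = k := by
    have : r ≤ k := Nat.div_le_self _ _
    omega
  have h4 := p_add_le j r
  rw [hjr] at h4
  have h5 : p r ^ 2 ^ N ≤ p j := (p_pow_le r N).trans (p_mono (by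
    rw [add_mul, one_mul] at hr3
    omega))
  refine lt_of_lt_of_le ?_ (Nat.cast_le.mpr h1 : ((p j : ℕ) : ℝ) ≤ (g star k : ℕ))
  have pk : (0 : ℝ) < p k := by exact_mod_cast p_pos k
  have pj : (0 : ℝ) < p j := by exact_mod_cast p_pos j
  have pr : (0 : ℝ) < p r := by exact_mod_cast p_pos r
  have hk : (0 : ℝ) < (k : ℝ) + 1 := by positivity
  rw [Real.rpow_lt_iff_lt_log pk pj]
  have l2 : A * Real.log ((k : ℝ) + 1) ≤ Real.log (p k) := by
    rw [← Real.log_pow]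
    exact Real.log_le_log (by positivity) (by exact_mod_cast h2)
  have l4 : Real.log (p k) ≤ 2 * Real.log ((k : ℝ) + 1) + (Real.log (p j) + Real.log (p r)) := by
    have : Real.log (p k) ≤ Real.log (((k : ℝ) + 1) ^ 2 * (p j * p r)) :=
      Real.log_le_log pk (by exact_mod_cast h4)
    rwa [Real.log_mul (by positivity) (by positivity), Real.log_mul pj.ne' pr.ne', Real.log_pow]
      at this
  have l5 : 2 ^ N * Real.log (p r) ≤ Real.log (p j) := by
    have : Real.log ((p r : ℝ) ^ 2 ^ N) ≤ Real.log (p j) :=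
      Real.log_le_log (by positivity) (by exact_mod_cast h5)
    rw [Real.log_pow] at this
    exact_mod_cast this
  have l0 : 0 < Real.log ((k : ℝ) + 1) := Real.log_pos (by
    have : (1 : ℝ) ≤ k := by exact_mod_cast h3
    linarith)
  set x := Real.log (p k)
  set y := Real.log (p j)
  set z := Real.log (p r)
  set l := Real.log ((k : ℝ) + 1)
  set B : ℝ := 2 ^ N with hB
  have hB0 : 0 < B := by positivity
  have hl : 4 * l ≤ (1 - c) * x := by
    have h6 := mul_le_mul_of_nonneg_left l2 h1c.le
    have h7 := mul_lt_mul_of_pos_right hA l0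
    linarith
  have hx : 0 < x := pos_of_mul_pos_right (by linarith) h1c.le
  have h6 := mul_le_mul_of_nonneg_left l4 hB0.le
  have h7 := mul_le_mul_of_nonneg_left hl hB0.le
  have h8 := mul_pos hx (sub_pos.mpr hN)
  have h9 : (2 * (B + 1)) * (c * x) < (2 * (B + 1)) * y := by linarith
  linarith [lt_of_mul_lt_mul_left h9 (by positivity)]

end Flagpole

theorem mainTheorem9 (star : Flagpole.Ptn → Flagpole.Ptn)
    (hinv : Function.Involutive star)
    (hsize : ∀ la : Flagpole.Ptn, (star la).size = la.size) :
    (∀ k : ℕ,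
      ∑ j ∈ Finset.Ico 1 k,
          2 * max 0 ((Flagpole.p j : ℤ) -
            2 * ∑ i ∈ Finset.Icc ((k : ℤ) - 3 - j) j, (Flagpole.q i j : ℤ))
        ≤ (Flagpole.g star k : ℤ)) ∧
    (∀ c : ℝ, c < 1 →
      ∀ᶠ k : ℕ in Filter.atTop, (Flagpole.p k : ℝ) ^ c < (Flagpole.g star k : ℝ)) := by
  exact ⟨Flagpole.sum_le_g hinv hsize, fun c hc => Flagpole.eventually_rpow_lt_g hinv hsize hc⟩
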